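/- Conventions. For points $p_1,\dots,p_4\in\mathbb R^3$ (indices modulo $4$) and $q\neq 0$, say that the line $(0,q)$ \emph{links} the skew quadrilateral with vertices $p_1,\dots,p_4$ (in this cyclic order) if the line through $0$ and $q$ does not meet the closed polygon $p_1p_2p_3p_4p_1$, the linking number of the line with the polygon (the number of times that the polygon winds around the line) is nonzero, and the linking takes place on the side of $q$, that is, the half-line from $0$ through $q$ meets the convex hull of $p_1,\dots,p_4$. Lemma. Fix real constants $\ell_i$, $k_i$, $h_i$ ($i=1,\dots,4$), $\epsilon$ and $\ell$ with $$\ell_i<\sqrt8,\quad k_i\in[2,2.61],\quad \epsilon\ge 2,\quad h_i\in[2,\sqrt8],\quad \ell\in[2,\sqrt8].$$ (1) Consider configurations of seven points $0,p_1,\dots,p_4,q_1,q_2$ in $\mathbb R^3$ such that $|p_i-q_j|\ge h_i$ for all $i,j$; $|q_1-q_2|\ge\epsilon$; all other pairs of distinct points among the seven have distance at least $2$ (so $|p_i|\ge2$, $|q_j|\ge2$, and $|p_i-p_{i'}|\ge2$ for $i\ne i'$); $|p_i|\le\ell_i$; $|q_j|\le\ell$; $|p_i-p_{i+1}|\le k_i$;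 and for $j=1,2$ the line $(0,q_j)$ links the skew quadrilateral with vertices $p_1,\dots,p_4$. If such a configuration exists, then there also exists such a configuration with the additional properties $$|p_i|=2,\quad |p_i-p_{i+1}|=k_i,\quad |q_j|=\ell\qquad(i=1,\dots,4,\ j=1,2).$$ (2) Consider configurations of six points $0,p_1,\dots,p_4,q$ in $\mathbb R^3$ such that $|p_i-q|\ge h_i$ for all $i$; all other pairs of distinct points among the six have distance at least $2$; $|p_i|\le\ell_i$; $|q|\le\ell$; $|p_i-p_{i+1}|\le k_i$; and the line $(0,q)$ links the skew quadrilateral with vertices $p_1,\dots,p_4$. If such a configuration exists, then there also exists such a configuration with $|p_i|=2$, $|p_i-p_{i+1}|=k_i$ and $|q|=\ell$ for all $i$. -/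

import Mathlib

/-- Euclidean three-space. -/
abbrev R3 : Type := EuclideanSpace ℝ (Fin 3)

/-- The signed dihedral angle, in `(-π, π]`, at the oriented line through `0` and `u`, from the
half-plane through `a` to the half-plane through `b`.  If `a'` and `b'` are the orthogonal
projections of `a` and `b` to the plane `u^⊥`, the complex number below has real part
`‖u‖² ⟪a', b'⟫` and imaginary part `‖u‖² ` times the signed area of the parallelogram spanned by
`a'` and `b'`, so that its argument is the oriented angle from `a'` to `b'`. -/
noncomputable def signedDihedralAngle (u a b : R3) : ℝ :=
  Complex.arg
    ⟨‖u‖ ^ 2 * inner ℝ a b - inner ℝ u a * inner ℝ u b,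
      ‖u‖ * dotProduct u.ofLp (crossProduct a.ofLp b.ofLp)⟩

/-- The linking number of the oriented line through `0` and `u` with the closed polygon
`p 0, p 1, …, p (n-1), p 0` (indices are cyclic): the number of times that the polygon winds
around the line.  It is meaningful when `u ≠ 0` and the polygon does not meet the line. -/
noncomputable def linkingNumber {n : ℕ} [NeZero n] (u : R3) (p : Fin n → R3) : ℝ :=
  (∑ i, signedDihedralAngle u (p i) (p (i + 1))) / (2 * Real.pi)

/-- The line through `0` and `u` links the closed polygon with consecutive vertices `p i`: it does
not meet the polygon, and the linking number is nonzero. -/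
def LineLinks {n : ℕ} [NeZero n] (u : R3) (p : Fin n → R3) : Prop :=
  u ≠ 0 ∧
  (∀ i, ∀ x ∈ segment ℝ (p i) (p (i + 1)), x ∉ Submodule.span ℝ {u}) ∧
  linkingNumber u p ≠ 0

/-- The line through `0` and `u` links the closed polygon with consecutive vertices `p i`, and it
does so on the side of `u`: the half-line from `0` through `u` meets the convex hull
of the polygon. -/
def HalfLineLinks {n : ℕ} [NeZero n] (u : R3) (p : Fin n → R3) : Prop :=
  LineLinks u p ∧ ∃ t : ℝ, 0 < t ∧ t • u ∈ convexHull ℝ (Set.range p)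

/-- A configuration of six points `0, p 0, …, p 3, q` with lower distance bounds
`h i` for `(p i, q)` and `2` for all other pairs, upper distance bounds `l i` for `(0, p i)`,
`L` for `(0, q)` and `k i` for `(p i, p (i + 1))` (indices modulo `4`),
in which the line `(0, q)` links the skew quadrilateral with vertices `p i`. -/
structure IsSixPointConfig (l k h : Fin 4 → ℝ) (L : ℝ) (p : Fin 4 → R3) (q : R3) : Prop where
  two_le_norm_p : ∀ i, 2 ≤ ‖p i‖
  two_le_norm_q : 2 ≤ ‖q‖
  two_le_dist_p : ∀ i j, i ≠ j → 2 ≤ dist (p i) (p j)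
  le_dist_p_q : ∀ i, h i ≤ dist (p i) q
  norm_p_le : ∀ i, ‖p i‖ ≤ l i
  norm_q_le : ‖q‖ ≤ L
  dist_p_le : ∀ i, dist (p i) (p (i + 1)) ≤ k i
  links : HalfLineLinks q p

/-- A configuration of seven points `0, p 0, …, p 3, q 0, q 1` with lower distance bounds
`h i` for `(p i, q j)`, `ε` for `(q 0, q 1)` and `2` for all other pairs, upper distance bounds
`l i` for `(0, p i)`, `L` for `(0, q j)` and `k i` for `(p i, p (i + 1))` (indices modulo `4`),
in which both lines `(0, q j)` link the skew quadrilateral with vertices `p i`. -/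
structure IsSevenPointConfig (l k h : Fin 4 → ℝ) (ε L : ℝ) (p : Fin 4 → R3) (q : Fin 2 → R3) :
    Prop where
  two_le_norm_p : ∀ i, 2 ≤ ‖p i‖
  two_le_norm_q : ∀ j, 2 ≤ ‖q j‖
  two_le_dist_p : ∀ i j, i ≠ j → 2 ≤ dist (p i) (p j)
  le_dist_p_q : ∀ i j, h i ≤ dist (p i) (q j)
  le_dist_q : ε ≤ dist (q 0) (q 1)
  norm_p_le : ∀ i, ‖p i‖ ≤ l i
  norm_q_le : ∀ j, ‖q j‖ ≤ L
  dist_p_le : ∀ i, dist (p i) (p (i + 1)) ≤ k i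
  links : ∀ j, HalfLineLinks (q j) p

/-! Moving each `q j` outwards along its ray up to norm `L` decreases no relevant distance and
leaves the lines unchanged. After that the `q j` stay fixed and only the vertices move, one at a
time. This works because linking can be replaced by sign conditions that are both open and closed.

Fix an axis `q`. A vertex of a triangle of consecutive vertices whose cone contains `q` has distance
at least √2 from the axis (`IsAxis.radius_of_mem_cone`), and then, since 2.61² < 4 + 2√2, every edge
turns by less than 3π/4 about the axis. By `not_backward` no edge turns backwards when the total
turning is 2π. So positive linking amounts to `Encircles`: every `triple q (p i) (p (i + 1))` is
positive, together with a cone condition. Negative linking becomes positive under x ↦ -x, and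
`IsAxis.not_encircles_neg` shows that all axes are linked in the same direction. Under the metric
constraints the strict signs are equivalent to weak signs plus the radius bound
(`Admissible.iff_weak`), so the admissible vertex systems form a compact set. Opposite vertices are
strictly more than 2 apart, so a small move of one vertex has to respect only the distances to the
origin, to its two neighbours and to the `q j`.

Minimise the sum of the norms. If a vertex of largest norm is longer than 2, first reflect it, if
necessary, in the plane through the origin and its neighbours, so that the corner has nonnegative
orientation. Rotating it about the line through its neighbours then shortens it. A tight constraint
with `q j` is relaxed, because the plane through the corner separates `q j` from the origin
(`IsAxis.triple_lt_sum`; its hard case is a Radon argument). Hence all norms are 2 at the minimum.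
Among these systems maximise the perimeter. If an edge is too short, rotating one end about the line
through the origin and its other neighbour lengthens this edge, keeps the norm and the other edge,
and moves the vertex away from every `q j`. Hence all edges are extremal at the maximum. -/

open scoped ComplexConjugate
open Real (pi)

/-! ### Vector algebra and cylindrical coordinates -/

/-- The scalar triple product of three vectors. -/
def triple (a b c : R3) : ℝ :=
  a 0 * (b 1 * c 2 - b 2 * c 1) + a 1 * (b 2 * c 0 - b 0 * c 2) + a 2 * (b 0 * c 1 - b 1 * c 0)

/-- The cross product of two vectors. -/
noncomputable def cross (a b : R3) : R3 :=
  !₂[a 1 * b 2 - a 2 * b 1, a 2 * b 0 - a 0 * b 2, a 0 * b 1 - a 1 * b 0]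

theorem inner_eq_coords (a b : R3) : inner ℝ a b = a 0 * b 0 + a 1 * b 1 + a 2 * b 2 := by
  simp [PiLp.inner_apply, Fin.sum_univ_three]; ring

theorem inner_cross_left (a b c : R3) : inner ℝ (cross a b) c = triple c a b := by
  simp [inner_eq_coords, cross, triple]
  ring

theorem inner_cross_right (a b c : R3) : inner ℝ c (cross a b) = triple c a b := by
  rw [real_inner_comm, inner_cross_left]

theorem dotProduct_crossProduct (a b c : R3) :
    dotProduct a.ofLp (crossProduct b.ofLp c.ofLp) = triple a b c := by
  simp [triple, crossProduct, dotProduct, Fin.sum_univ_three]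

theorem triple_rotate (a b c : R3) : triple a b c = triple b c a := by
  simp only [triple]; ring

theorem triple_swap (a b c : R3) : triple a c b = -triple a b c := by
  simp only [triple]; ring

theorem triple_self_left (a b : R3) : triple a a b = 0 := by
  simp only [triple]; ring

theorem triple_self_outer (a b : R3) : triple a b a = 0 := by
  simp only [triple]; ring

theorem triple_neg_neg_neg (a b c : R3) : triple (-a) (-b) (-c) = -triple a b c := by
  simp only [triple, PiLp.neg_apply]; ring

theorem triple_smul_left (t : ℝ) (a b c : R3) : triple (t • a) b c = t * triple a b c := by
  simp only [triple, PiLp.smul_apply, smul_eq_mul]; ring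

/-- Cramer's rule: `q` in terms of `a`, `p`, `b`. -/
theorem triple_cramer (a p b q : R3) :
    triple a p b • q = triple q p b • a + triple q b a • p + triple q a p • b := by
  ext i
  fin_cases i <;> simp [triple] <;> ring

/-- Cylindrical coordinates about the axis spanned by `q`: the projection along `q` to the
orthogonal plane, identified with the complex plane. -/
theorem exists_cylindrical (q : R3) (hq : q ≠ 0) :
    ∃ w : R3 →ₗ[ℝ] ℂ,
      (∀ a b, inner ℝ a b = (inner ℝ q a / ‖q‖) * (inner ℝ q b / ‖q‖) + (conj (w a) * w b).re) ∧
      (∀ a b, triple q a b = ‖q‖ * (conj (w a) * w b).im) := by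
  have hn : 0 < ‖q‖ := norm_pos_iff.2 hq
  have hfr : Module.finrank ℝ (ℝ ∙ q)ᗮ = 2 := by
    have h1 := Submodule.finrank_add_finrank_orthogonal (ℝ ∙ q)
    rw [finrank_span_singleton hq] at h1
    simp at h1
    omega
  obtain ⟨⟨e, he⟩, he0⟩ : ∃ e : (ℝ ∙ q)ᗮ, e ≠ 0 := by
    have : Nontrivial (ℝ ∙ q)ᗮ := Module.nontrivial_of_finrank_pos (R := ℝ) (by omega)
    exact exists_ne 0
  have hqe : inner ℝ q e = 0 := Submodule.mem_orthogonal_singleton_iff_inner_right.1 he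
  have he0' : e ≠ 0 := fun h => he0 (by ext1; exact h)
  have hne : 0 < ‖e‖ := norm_pos_iff.2 he0'
  set n : ℝ := ‖q‖ with hndef
  set m : ℝ := ‖e‖ with hmdef
  have hqq : q 0 * q 0 + q 1 * q 1 + q 2 * q 2 = n ^ 2 := by
    rw [← inner_eq_coords, real_inner_self_eq_norm_sq]
  have hee : e 0 * e 0 + e 1 * e 1 + e 2 * e 2 = m ^ 2 := by
    rw [← inner_eq_coords, real_inner_self_eq_norm_sq]
  rw [inner_eq_coords] at hqe
  -- These are the coordinates in the orthonormal basis e/m, (q × e)/(nm) of the plane orthogonal to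
  -- `q`.
  let w : R3 →ₗ[ℝ] ℂ :=
    { toFun := fun a => ⟨inner ℝ e a / m, triple q e a / (n * m)⟩
      map_add' := by
        intro a b
        apply Complex.ext <;> simp [triple, inner_add_right] <;> ring
      map_smul' := by
        intro t a
        apply Complex.ext <;> simp [triple, inner_smul_right] <;> ring }
  have hre : ∀ a b, (conj (w a) * w b).re =
      (inner ℝ e a * inner ℝ e b * n ^ 2 + triple q e a * triple q e b) / (n ^ 2 * m ^ 2) := by
    intro a b
    simp [w]
    field_simp
  have him : ∀ a b, (conj (w a) * w b).im =
      (inner ℝ e a * triple q e b - triple q e a * inner ℝ e b) / (n * m ^ 2) := by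
    intro a b
    simp [w]
    field_simp
    ring
  refine ⟨w, fun a b => ?_, fun a b => ?_⟩
  · rw [hre, div_mul_div_comm, ← sub_eq_zero]
    have key : inner ℝ a b * (n ^ 2 * m ^ 2) = inner ℝ q a * inner ℝ q b * m ^ 2 +
        inner ℝ e a * inner ℝ e b * n ^ 2 + triple q e a * triple q e b := by
      simp only [inner_eq_coords, triple]
      rw [← hqq, ← hee]
      linear_combination ((q 0 * e 0 + q 1 * e 1 + q 2 * e 2) * (a 0 * b 0 + a 1 * b 1 + a 2 * b 2) - (e 0 * b 0 + e 1 * b 1 + e 2 * b 2) * (q 0 * a 0 + q 1 * a 1 + q 2 * a 2) - (q 0 * b 0 + q 1 * b 1 + q 2 * b 2) * (e 0 * a 0 + e 1 * a 1 + e 2 * a 2)) * hqe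
    field_simp
    linarith
  · rw [him]
    have key : triple q a b * m ^ 2 = inner ℝ e a * triple q e b - triple q e a * inner ℝ e b := by
      simp only [inner_eq_coords, triple]
      rw [← hee]
      linear_combination (e 0 * (a 1 * b 2 - a 2 * b 1) + e 1 * (a 2 * b 0 - a 0 * b 2) + e 2 * (a 0 * b 1 - a 1 * b 0)) * hqe
    field_simp
    linarith

/-! ### Metric constraints and distance estimates -/

/-- Four vertices satisfying the metric constraints common to all configurations. -/
structure IsFrame (p : Fin 4 → R3) : Prop where
  two_le_norm : ∀ i, 2 ≤ ‖p i‖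
  norm_lt : ∀ i, ‖p i‖ < √8
  two_le_dist : ∀ i j, i ≠ j → 2 ≤ dist (p i) (p j)
  dist_le : ∀ i, dist (p i) (p (i + 1)) ≤ 2.61

/-- The metric constraints on a point `q` relative to a frame. -/
structure IsAxis (p : Fin 4 → R3) (q : R3) : Prop where
  two_le_norm : 2 ≤ ‖q‖
  norm_le : ‖q‖ ≤ √8
  two_le_dist : ∀ i, 2 ≤ dist (p i) q

/-- Every vector that is positive on all `p i` is nonnegative on `q`. -/
def InDualCone (p : Fin 4 → R3) (q : R3) : Prop :=
  ∀ v : R3, (∀ i, 0 < inner ℝ v (p i)) → 0 ≤ inner ℝ v q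

theorem dist_sq_eq (a b : R3) : dist a b ^ 2 = ‖a‖ ^ 2 - 2 * inner ℝ a b + ‖b‖ ^ 2 := by
  rw [dist_eq_norm, norm_sub_sq_real]

theorem four_le_dist_sq {a b : R3} (h : 2 ≤ dist a b) :
    4 ≤ ‖a‖ ^ 2 - 2 * inner ℝ a b + ‖b‖ ^ 2 := by
  rw [← dist_sq_eq]; nlinarith

theorem dist_sq_le {a b : R3} (h : dist a b ≤ 2.61) :
    ‖a‖ ^ 2 - 2 * inner ℝ a b + ‖b‖ ^ 2 ≤ 6.8121 := by
  rw [← dist_sq_eq]; nlinarith [dist_nonneg (x := a) (y := b)]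

theorem four_le_norm_sq {a : R3} (h : 2 ≤ ‖a‖) : 4 ≤ ‖a‖ ^ 2 := by nlinarith

theorem norm_sq_lt {a : R3} (h : ‖a‖ < √8) : ‖a‖ ^ 2 < 8 := by
  have := Real.sq_sqrt (show (0 : ℝ) ≤ 8 by norm_num)
  nlinarith [norm_nonneg a]

theorem norm_sq_le {a : R3} (h : ‖a‖ ≤ √8) : ‖a‖ ^ 2 ≤ 8 := by
  have := Real.sq_sqrt (show (0 : ℝ) ≤ 8 by norm_num)
  nlinarith [norm_nonneg a]

namespace IsFrame

variable {p : Fin 4 → R3}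

theorem inner_pos (hp : IsFrame p) (i : Fin 4) : 0 < inner ℝ (p i) (p (i + 1)) := by
  have h1 := four_le_norm_sq (hp.two_le_norm i)
  have h2 := four_le_norm_sq (hp.two_le_norm (i + 1))
  have h3 := dist_sq_le (hp.dist_le i)
  linarith

theorem inner_pos' (hp : IsFrame p) (i : Fin 4) : 0 < inner ℝ (p (i + 1)) (p i) := by
  rw [real_inner_comm]; exact hp.inner_pos i

/-- Consecutive vertices make acute angles, so `p 0` and `p 2` are not opposite in direction (both
are acute to `p 1`), and their angle bisector serves as `u`. The functional `u` later fixes signs in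
Cramer's rule. -/
theorem exists_hemisphere (hp : IsFrame p) : ∃ u : R3, ∀ i, 0 < inner ℝ u (p i) := by
  have h0 : 0 < ‖p 0‖ := by linarith [hp.two_le_norm 0]
  have h2 : 0 < ‖p 2‖ := by linarith [hp.two_le_norm 2]
  have h01 : 0 < inner ℝ (p 0) (p 1) := hp.inner_pos 0
  have h12 : 0 < inner ℝ (p 2) (p 1) := hp.inner_pos' 1
  have h23 : 0 < inner ℝ (p 2) (p 3) := hp.inner_pos 2
  have h30 : 0 < inner ℝ (p 0) (p 3) := hp.inner_pos' 3
  have h02 : 0 < ‖p 0‖ * ‖p 2‖ + inner ℝ (p 0) (p 2) := by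
    have h := neg_le_of_abs_le (abs_real_inner_le_norm (p 0) (p 2))
    rcases h.lt_or_eq with h | h
    · linarith
    · exfalso
      have h' : inner ℝ (p 0) (p 2) = -(‖p 0‖ * ‖p 2‖) := h.symm
      have h'' : inner ℝ (p 0) (p 2) / (‖p 0‖ * ‖p 2‖) = -1 := by
        rw [h']; field_simp
      obtain ⟨-, r, hr, h2'⟩ := real_inner_div_norm_mul_norm_eq_neg_one_iff _ _ |>.1 h''
      rw [h2', real_inner_smul_left] at h12
      nlinarith
  refine ⟨‖p 2‖ • p 0 + ‖p 0‖ • p 2, fun i => ?_⟩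
  fin_cases i
  · simp only [Fin.zero_eta, inner_add_left, real_inner_smul_left, real_inner_self_eq_norm_sq]
    rw [real_inner_comm (p 0) (p 2)] at *
    nlinarith
  · simp only [Fin.mk_one, inner_add_left, real_inner_smul_left]
    exact add_pos (mul_pos h2 h01) (mul_pos h0 h12)
  · simp only [Fin.reduceFinMk, inner_add_left, real_inner_smul_left, real_inner_self_eq_norm_sq]
    nlinarith
  · simp only [Fin.reduceFinMk, inner_add_left, real_inner_smul_left]
    exact add_pos (mul_pos h2 h30) (mul_pos h0 h23)

end IsFrame

/-- A point at distance at least `2` from three points of norm less than `√8` in whose cone it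
lies is beyond the plane through these points. -/
theorem one_lt_of_mem_cone {a b c x : R3} {α β γ : ℝ} (hα : 0 ≤ α) (hβ : 0 ≤ β) (hγ : 0 ≤ γ)
    (hx : x = α • a + β • b + γ • c) (hx2 : 2 ≤ ‖x‖) (ha : ‖a‖ < √8) (hb : ‖b‖ < √8)
    (hc : ‖c‖ < √8) (hxa : 2 ≤ dist a x) (hxb : 2 ≤ dist b x) (hxc : 2 ≤ dist c x) :
    1 < α + β + γ := by
  have h0 := four_le_norm_sq hx2
  have ha' := four_le_dist_sq hxa
  have hb' := four_le_dist_sq hxb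
  have hc' := four_le_dist_sq hxc
  have ha2 := norm_sq_lt ha
  have hb2 := norm_sq_lt hb
  have hc2 := norm_sq_lt hc
  have hxx : ‖x‖ ^ 2 = α * inner ℝ a x + β * inner ℝ b x + γ * inner ℝ c x := by
    rw [← real_inner_self_eq_norm_sq]
    nth_rewrite 1 [hx]
    simp only [inner_add_left, real_inner_smul_left]
  have hA : α * (2 * inner ℝ a x) ≤ α * (‖x‖ ^ 2 + 4) := by
    apply mul_le_mul_of_nonneg_left _ hα; linarith
  have hB : β * (2 * inner ℝ b x) ≤ β * (‖x‖ ^ 2 + 4) := by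
    apply mul_le_mul_of_nonneg_left _ hβ; linarith
  have hC : γ * (2 * inner ℝ c x) ≤ γ * (‖x‖ ^ 2 + 4) := by
    apply mul_le_mul_of_nonneg_left _ hγ; linarith
  by_contra hle
  push Not at hle
  have hpos : 0 < α + β + γ := by
    by_contra h
    have : α = 0 := by linarith
    have : β = 0 := by linarith
    have : γ = 0 := by linarith
    subst_vars
    simp at h0
    linarith
  have hs : (α + β + γ) * (‖x‖ ^ 2 + 4) ≤ 1 * (‖x‖ ^ 2 + 4) := by
    apply mul_le_mul_of_nonneg_right hle; positivity
  rcases hα.lt_or_eq with h | h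
  · nlinarith
  rcases hβ.lt_or_eq with h | h
  · nlinarith
  rcases hγ.lt_or_eq with h | h
  · nlinarith
  · linarith

/-- Moving `q` away from the origin increases its distance to a point of norm at most `√8` and
distance at least `2`. -/
theorem dist_le_dist_smul {a q : R3} {t : ℝ} (ht : 1 ≤ t) (hq : 2 ≤ ‖q‖) (ha : ‖a‖ ≤ √8)
    (haq : 2 ≤ dist a q) : dist a q ≤ dist a (t • q) := by
  have h0 := four_le_norm_sq hq
  have h1 := four_le_dist_sq haq
  have h2 := norm_sq_le ha
  refine (sq_le_sq₀ dist_nonneg dist_nonneg).1 ?_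
  rw [dist_sq_eq, dist_sq_eq, norm_smul, Real.norm_eq_abs, mul_pow, sq_abs, real_inner_smul_right]
  have h3 : inner ℝ a q ≤ ‖q‖ ^ 2 := by linarith
  nlinarith [mul_nonneg (sub_nonneg.2 ht) (sub_nonneg.2 h3),
    mul_nonneg (sub_nonneg.2 ht) (mul_nonneg (sub_nonneg.2 ht) (sq_nonneg ‖q‖))]

/-! ### Angle estimates between directions -/

/-- The path from `x` to `z` over `q` is shorter than the path over `y` if `q` lies in the cone
of `x`, `y`, `z`. -/
theorem angle_add_angle_le_of_mem_cone {x y z q : R3} {α β γ : ℝ} (hα : 0 ≤ α) (hβ : 0 ≤ β)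
    (hγ : 0 ≤ γ) (hq : q = α • x + β • y + γ • z) (hq0 : q ≠ 0) (hw0 : β • y + γ • z ≠ 0) :
    InnerProductGeometry.angle x q + InnerProductGeometry.angle q z ≤
      InnerProductGeometry.angle x y + InnerProductGeometry.angle y z := by
  open InnerProductGeometry in
  lift α to NNReal using hα
  lift β to NNReal using hβ
  lift γ to NNReal using hγ
  set w := (β : ℝ) • y + (γ : ℝ) • z with hw
  have h1 : angle x w = angle x q + angle q w := by
    apply angle_eq_angle_add_add_angle_add_of_mem_span hq0
    rw [Submodule.mem_span_pair]
    exact ⟨α, 1, by rw [hq, add_assoc]; simp [NNReal.smul_def, hw]⟩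
  have h2 : angle y z = angle y w + angle w z := by
    apply angle_eq_angle_add_add_angle_add_of_mem_span hw0
    rw [Submodule.mem_span_pair]
    exact ⟨β, γ, by simp [NNReal.smul_def, hw]⟩
  have h3 := angle_le_angle_add_angle q w z
  have h4 := angle_le_angle_add_angle x y w
  linarith

theorem angle_le_of_dist_le {x y : R3} (hx : 2 ≤ ‖x‖) (hy : 2 ≤ ‖y‖) (h : dist x y ≤ 2.61) :
    InnerProductGeometry.angle x y ≤ Real.pi / 2 - 0.148 := by
  have h1 := dist_sq_le h
  have hxy : 0 < ‖x‖ * ‖y‖ := by positivity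
  -- The worst case is ‖x‖ = ‖y‖ = 2, where the quotient is (8 - 6.8121)/8 ≈ 0.1485.
  have hc : 0.148 ≤ inner ℝ x y / (‖x‖ * ‖y‖) := by
    rw [le_div_iff₀ hxy]
    nlinarith [mul_nonneg (sub_nonneg.2 hx) (sub_nonneg.2 hy), sq_nonneg (‖x‖ - ‖y‖)]
  unfold InnerProductGeometry.angle
  rw [Real.arccos_eq_pi_div_two_sub_arcsin]
  have h2 : (0.148 : ℝ) ≤ Real.arcsin 0.148 := by
    have := Real.sin_le (show (0 : ℝ) ≤ 0.148 by norm_num)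
    calc (0.148 : ℝ) = Real.arcsin (Real.sin 0.148) :=
          (Real.arcsin_sin (by linarith [Real.pi_gt_three]) (by linarith [Real.pi_gt_three])).symm
      _ ≤ _ := Real.monotone_arcsin this
  have h3 := Real.monotone_arcsin hc
  linarith

theorem pi_div_six_le_angle {x y : R3} (hx : 2 ≤ ‖x‖) (hy : 2 ≤ ‖y‖) (hx' : ‖x‖ ≤ √8)
    (hy' : ‖y‖ ≤ √8) (h : 2 ≤ dist x y) : Real.pi / 6 ≤ InnerProductGeometry.angle x y := by
  have h1 := four_le_dist_sq h
  have hxy : 0 < ‖x‖ * ‖y‖ := by positivity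
  have hs : √8 ≤ 2.83 := by rw [Real.sqrt_le_left] <;> norm_num
  have h3 : (1.72 : ℝ) ≤ √3 := by apply Real.le_sqrt_of_sq_le; norm_num
  have hc : inner ℝ x y / (‖x‖ * ‖y‖) ≤ √3 / 2 := by
    rw [div_le_iff₀ hxy]
    have : inner ℝ x y ≤ 0.86 * (‖x‖ * ‖y‖) := by
      nlinarith [mul_nonneg (sub_nonneg.2 hx) (sub_nonneg.2 (hy'.trans hs)),
        mul_nonneg (sub_nonneg.2 hy) (sub_nonneg.2 (hx'.trans hs)),
        mul_nonneg (sub_nonneg.2 hx) (sub_nonneg.2 (hx'.trans hs)),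
        mul_nonneg (sub_nonneg.2 hy) (sub_nonneg.2 (hy'.trans hs)),
        mul_nonneg (sub_nonneg.2 hx) (sub_nonneg.2 hy)]
    nlinarith
  have h4 := Real.antitone_arccos hc
  rw [← Real.cos_pi_div_six, Real.arccos_cos (by positivity) (by linarith [Real.pi_pos])] at h4
  exact h4

/-- A vertex of a frame triangle containing the direction `q` is not nearly opposite to `q`. -/
theorem neg_lt_inner_of_mem_cone {p a c q : R3} {α β γ : ℝ} (hα : 0 ≤ α) (hβ : 0 ≤ β)
    (hγ : 0 ≤ γ) (hq : q = α • p + β • a + γ • c) (hp : 2 ≤ ‖p‖) (ha : 2 ≤ ‖a‖) (hc : 2 ≤ ‖c‖)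
    (hc' : ‖c‖ ≤ √8) (hq2 : 2 ≤ ‖q‖) (hq' : ‖q‖ ≤ √8) (hpa : dist p a ≤ 2.61)
    (hac : dist a c ≤ 2.61) (hcq : 2 ≤ dist c q) :
    -(√2 / 2 * (‖p‖ * ‖q‖)) < inner ℝ p q := by
  open InnerProductGeometry in
  have hq0 : q ≠ 0 := by rintro rfl; simp at hq2; linarith
  have hpq : 0 < ‖p‖ * ‖q‖ := by positivity
  by_cases hw0 : β • a + γ • c = 0
  · rw [add_assoc, hw0, add_zero] at hq
    have : 0 ≤ inner ℝ p q := by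
      rw [hq, real_inner_smul_right, real_inner_self_eq_norm_sq]; positivity
    have : 0 < √2 / 2 * (‖p‖ * ‖q‖) := by positivity
    linarith
  have h1 := angle_add_angle_le_of_mem_cone hα hβ hγ hq hq0 hw0
  have h2 := angle_le_of_dist_le hp ha hpa
  have h3 := angle_le_of_dist_le ha hc hac
  have h4 := pi_div_six_le_angle hq2 hc hq' hc' (by rwa [dist_comm])
  -- The angle is at most 2(π/2 - 0.148) - π/6, and π/12 < 0.296.
  have h5 : angle p q < Real.pi - Real.pi / 4 := by linarith [Real.pi_lt_d2]
  have h6 := Real.cos_lt_cos_of_nonneg_of_le_pi (angle_nonneg p q)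
    (by linarith [Real.pi_pos]) h5
  rw [Real.cos_pi_sub, Real.cos_pi_div_four, cos_angle, lt_div_iff₀ hpq] at h6
  linarith

/-! ### Planar estimates: no edge turns backwards -/

theorem re_conj_mul_eq (a b : ℂ) :
    (conj a * b).re = ‖a‖ * ‖b‖ * Real.cos (Complex.arg (conj a * b)) := by
  have h := Complex.norm_mul_cos_arg (conj a * b)
  rw [← h]; simp

theorem im_conj_mul_eq (a b : ℂ) :
    (conj a * b).im = ‖a‖ * ‖b‖ * Real.sin (Complex.arg (conj a * b)) := by
  have h := Complex.norm_mul_sin_arg (conj a * b)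
  rw [← h]; simp

theorem norm_sub_sq_complex (a b : ℂ) :
    ‖a - b‖ ^ 2 = ‖a‖ ^ 2 + ‖b‖ ^ 2 - 2 * (conj a * b).re := by
  simp only [← Complex.normSq_eq_norm_sq, Complex.normSq_apply]
  simp
  ring

/-- At an angle of 3π/4 or more, the law of cosines makes the squared distance at least 4 + 2√2 >
6.8121. This is where the bound 2.61 is nearly sharp. -/
theorem arg_le_of_close {a b : ℂ} (ha : 2 ≤ ‖a‖ ^ 2) (hb : 2 ≤ ‖b‖ ^ 2)
    (h : ‖a - b‖ ^ 2 ≤ 6.8121) :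
    |Complex.arg (conj a * b)| < 3 * pi / 4 := by
  have hab : 2 ≤ ‖a‖ * ‖b‖ := by
    have : 2 ^ 2 ≤ (‖a‖ * ‖b‖) ^ 2 := by rw [mul_pow]; nlinarith
    exact (sq_le_sq₀ (by norm_num) (by positivity)).1 this
  rw [norm_sub_sq_complex, re_conj_mul_eq] at h
  by_contra hc
  push Not at hc
  have h1 : Real.cos |Complex.arg (conj a * b)| ≤ Real.cos (pi - pi / 4) := by
    apply Real.cos_le_cos_of_nonneg_of_le_pi
    · linarith [Real.pi_pos]
    · exact Complex.abs_arg_le_pi _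
    · linarith
  rw [Real.cos_abs, Real.cos_pi_sub, Real.cos_pi_div_four] at h1
  have h2 : (1.414 : ℝ) ≤ √2 := by apply Real.le_sqrt_of_sq_le; norm_num
  nlinarith [sq_nonneg (‖a‖ - ‖b‖)]

/-- The lower bound for a horizontal and vertical distance that is forced on two points outside the
balls of radius `2` about the points `±√2` of the axis. -/
theorem four_add_le_of_outside {r s y x : ℝ} (hy : |y| ≤ √2) (hr₁ : 4 ≤ r + (y + √2) ^ 2)
    (hr₂ : 4 ≤ r + (y - √2) ^ 2) (hs₁ : 4 ≤ s + (x + √2) ^ 2) (hs₂ : 4 ≤ s + (x - √2) ^ 2) :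
    4 + 2 * √2 * |y| ≤ r + s + (y - x) ^ 2 := by
  have h2 : √2 ^ 2 = 2 := Real.sq_sqrt (by norm_num)
  have h2' : 0 < √2 := by positivity
  have h3 : 2 + 2 * √2 * |y| ≤ r + y ^ 2 := by
    rcases abs_cases y with ⟨h, _⟩ | ⟨h, _⟩ <;> rw [h] <;> nlinarith
  have h4 : 2 + 2 * √2 * |x| ≤ s + x ^ 2 := by
    rcases abs_cases x with ⟨h, _⟩ | ⟨h, _⟩ <;> rw [h] <;> nlinarith
  have h5 : y * x ≤ √2 * |x| :=
    calc y * x ≤ |y * x| := le_abs_self _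
      _ = |y| * |x| := abs_mul _ _
      _ ≤ √2 * |x| := mul_le_mul_of_nonneg_right hy (abs_nonneg _)
  nlinarith

theorem two_le_mul_of_sq {r s : ℝ} (hr : 0 ≤ r) (hs : 0 ≤ s) (hr2 : 2 ≤ r ^ 2) (hs2 : 2 ≤ s ^ 2) :
    2 ≤ r * s := by
  have : 2 ^ 2 ≤ (r * s) ^ 2 := by rw [mul_pow]; nlinarith
  exact (sq_le_sq₀ (by norm_num) (by positivity)).1 this

theorem sq_add_sq_sub_lt {r s : ℝ} (hr : 0 ≤ r) (hs : 0 ≤ s) (hr2 : 2 ≤ r ^ 2) (hs2 : 2 ≤ s ^ 2)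
    (hr' : r ^ 2 ≤ 4.8121) (hs' : s ^ 2 ≤ 4.8121) :
    r ^ 2 + s ^ 2 - 1.4142 * (r * s) < 3 := by
  have r1v : r ≤ 2.194 := by nlinarith
  have r2v : s ≤ 2.194 := by nlinarith
  have r1l : 1.414 ≤ r := by nlinarith
  have r2l : 1.414 ≤ s := by nlinarith
  nlinarith [mul_nonneg (sub_nonneg.2 r1v) (sub_nonneg.2 r2v),
    mul_nonneg (sub_nonneg.2 r1l) (sub_nonneg.2 r2l),
    mul_nonneg (sub_nonneg.2 r1l) (sub_nonneg.2 r2v),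
    mul_nonneg (sub_nonneg.2 r2l) (sub_nonneg.2 r1v)]

theorem sub_sq_le_of_abs_le {s y y' a b : ℝ} (hs : 1.4142 ≤ s)
    (ha : 2 * s * |y| + 4 * a ≤ 2.8121) (hb : 2 * s * |y'| + 4 * b ≤ 2.8121)
    (hab : s / 2 ≤ a + b) : (y - y') ^ 2 ≤ 0.979 := by
  have h : |y - y'| ≤ |y| + |y'| := abs_sub y y'
  have h0 : |y - y'| ≤ 0.989 := by nlinarith [abs_nonneg (y - y')]
  rw [← sq_abs]
  nlinarith [abs_nonneg (y - y')]

/-- In sum-to-product form, the half-sum lies in [5π/8, 3π/4] and the half-difference in [-π/8,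
π/8], so the value is at least 2 sin(π/8) cos(π/8) = sin(π/4). -/
theorem neg_cos_add_neg_cos_ge {s t : ℝ} (h : 5 * pi / 4 ≤ s + t) (hs : s ≤ 3 * pi / 4)
    (ht : t ≤ 3 * pi / 4) : √2 / 2 ≤ -Real.cos s - Real.cos t := by
  have h1 : Real.cos s + Real.cos t = 2 * Real.cos ((s + t) / 2) * Real.cos ((s - t) / 2) :=
    Real.cos_add_cos s t
  have h2 : Real.sin (pi / 8) ≤ -Real.cos ((s + t) / 2) := by
    have : Real.sin (pi / 8) = -Real.cos (pi / 8 + pi / 2) := by rw [Real.cos_add_pi_div_two]; ring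
    rw [this, neg_le_neg_iff]
    apply Real.cos_le_cos_of_nonneg_of_le_pi <;> linarith [Real.pi_pos]
  have h3 : Real.cos (pi / 8) ≤ Real.cos ((s - t) / 2) := by
    rw [← Real.cos_abs ((s - t) / 2)]
    apply Real.cos_le_cos_of_nonneg_of_le_pi (abs_nonneg _) (by linarith [Real.pi_pos])
    rw [abs_le]; constructor <;> linarith
  have h4 : 2 * Real.sin (pi / 8) * Real.cos (pi / 8) = √2 / 2 := by
    rw [← Real.sin_two_mul, ← Real.sin_pi_div_four]; congr 1; ring
  have h5 : 0 ≤ Real.sin (pi / 8) :=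
    Real.sin_nonneg_of_nonneg_of_le_pi (by positivity) (by linarith [Real.pi_pos])
  have h6 : 0 ≤ Real.cos (pi / 8) :=
    Real.cos_nonneg_of_neg_pi_div_two_le_of_le (by linarith [Real.pi_pos]) (by linarith [Real.pi_pos])
  nlinarith [mul_le_mul h2 h3 h6 (h5.trans h2)]

set_option maxHeartbeats 1000000 in
/-- No quadrilateral with the given distances winds once around the axis while one of its edges
turns backwards. -/
theorem not_backward {w₁ w₂ w₃ w₄ : ℂ} {z₁ z₂ z₃ z₄ : ℝ}
    (hw₁ : 2 ≤ ‖w₁‖ ^ 2) (hw₂ : 2 ≤ ‖w₂‖ ^ 2) (hw₃ : 2 ≤ ‖w₃‖ ^ 2) (hw₄ : 2 ≤ ‖w₄‖ ^ 2)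
    (h₁ : ‖w₁‖ ^ 2 + z₁ ^ 2 < 8) (h₂ : ‖w₂‖ ^ 2 + z₂ ^ 2 < 8)
    (ho₁ : 4 ≤ ‖w₁‖ ^ 2 + z₁ ^ 2) (ho₂ : 4 ≤ ‖w₂‖ ^ 2 + z₂ ^ 2) (ho₃ : 4 ≤ ‖w₃‖ ^ 2 + z₃ ^ 2)
    (ho₄ : 4 ≤ ‖w₄‖ ^ 2 + z₄ ^ 2)
    (hq₁ : 4 ≤ ‖w₁‖ ^ 2 + (z₁ - √8) ^ 2) (hq₂ : 4 ≤ ‖w₂‖ ^ 2 + (z₂ - √8) ^ 2)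
    (hq₃ : 4 ≤ ‖w₃‖ ^ 2 + (z₃ - √8) ^ 2) (hq₄ : 4 ≤ ‖w₄‖ ^ 2 + (z₄ - √8) ^ 2)
    (h12 : 4 ≤ ‖w₁ - w₂‖ ^ 2 + (z₁ - z₂) ^ 2)
    (h23 : ‖w₂ - w₃‖ ^ 2 + (z₂ - z₃) ^ 2 ≤ 6.8121)
    (h34 : ‖w₃ - w₄‖ ^ 2 + (z₃ - z₄) ^ 2 ≤ 6.8121)
    (h41 : ‖w₄ - w₁‖ ^ 2 + (z₄ - z₁) ^ 2 ≤ 6.8121)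
    (i23 : 0 < z₂ * z₃ + (conj w₂ * w₃).re) (i34 : 0 < z₃ * z₄ + (conj w₃ * w₄).re)
    (i41 : 0 < z₄ * z₁ + (conj w₄ * w₁).re)
    (hz : ¬ (z₁ < 0 ∧ z₂ < 0 ∧ z₃ < 0 ∧ z₄ < 0))
    (hs : Complex.arg (conj w₁ * w₂) + Complex.arg (conj w₂ * w₃) + Complex.arg (conj w₃ * w₄) +
      Complex.arg (conj w₄ * w₁) = 2 * pi) :
    0 < Complex.arg (conj w₁ * w₂) := by
  by_contra hθ
  push Not at hθ
  have ht2 := arg_le_of_close hw₂ hw₃ (by nlinarith [sq_nonneg (z₂ - z₃)])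
  have ht3 := arg_le_of_close hw₃ hw₄ (by nlinarith [sq_nonneg (z₃ - z₄)])
  have ht4 := arg_le_of_close hw₄ hw₁ (by nlinarith [sq_nonneg (z₄ - z₁)])
  have e1 := re_conj_mul_eq w₁ w₂
  have e2 := re_conj_mul_eq w₂ w₃
  have e3 := re_conj_mul_eq w₃ w₄
  have e4 := re_conj_mul_eq w₄ w₁
  rw [norm_sub_sq_complex] at h12 h23 h34 h41
  generalize (conj w₁ * w₂).re = x1 at *
  generalize (conj w₂ * w₃).re = x2 at *
  generalize (conj w₃ * w₄).re = x3 at *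
  generalize (conj w₄ * w₁).re = x4 at *
  generalize Complex.arg (conj w₁ * w₂) = t1 at *
  generalize Complex.arg (conj w₂ * w₃) = t2 at *
  generalize Complex.arg (conj w₃ * w₄) = t3 at *
  generalize Complex.arg (conj w₄ * w₁) = t4 at *
  have n1 := norm_nonneg w₁
  have n2 := norm_nonneg w₂
  have n3 := norm_nonneg w₃
  have n4 := norm_nonneg w₄
  generalize ‖w₁‖ = r1 at *
  generalize ‖w₂‖ = r2 at *
  generalize ‖w₃‖ = r3 at *
  generalize ‖w₄‖ = r4 at *
  have hpi := Real.pi_pos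
  rw [abs_lt] at ht2 ht3 ht4
  -- The other three angles are below 3π/4, so `t1` > -π/4; since `t1` ≤ 0, each of the others
  -- exceeds π/2.
  have c1 : √2 / 2 ≤ Real.cos t1 := by
    rw [← Real.cos_pi_div_four, ← Real.cos_neg t1]
    apply Real.cos_le_cos_of_nonneg_of_le_pi <;> linarith
  have c2 : Real.cos t2 < 0 := by
    apply Real.cos_neg_of_pi_div_two_lt_of_lt <;> linarith
  have c3 : Real.cos t3 < 0 := by
    apply Real.cos_neg_of_pi_div_two_lt_of_lt <;> linarith
  have c4 : Real.cos t4 < 0 := by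
    apply Real.cos_neg_of_pi_div_two_lt_of_lt <;> linarith
  -- With `t1` ≤ 0 and `t3` < 3π/4, at least 5π/4 is left for `t2 + t4`.
  have c24 := neg_cos_add_neg_cos_ge (s := t2) (t := t4) (by linarith) (by linarith) (by linarith)
  generalize Real.cos t1 = C1 at *
  generalize Real.cos t2 = C2 at *
  generalize Real.cos t3 = C3 at *
  generalize Real.cos t4 = C4 at *
  have p23 := two_le_mul_of_sq n2 n3 hw₂ hw₃
  have p34 := two_le_mul_of_sq n3 n4 hw₃ hw₄
  have p41 := two_le_mul_of_sq n4 n1 hw₄ hw₁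
  have x2' : x2 ≤ 2 * C2 := by rw [e2]; exact mul_le_mul_of_nonpos_right p23 c2.le
  have x3' : x3 ≤ 2 * C3 := by rw [e3]; exact mul_le_mul_of_nonpos_right p34 c3.le
  have x4' : x4 ≤ 2 * C4 := by rw [e4]; exact mul_le_mul_of_nonpos_right p41 c4.le
  have z23 : 0 < z₂ * z₃ := by linarith
  have z34 : 0 < z₃ * z₄ := by linarith
  have z41 : 0 < z₄ * z₁ := by linarith
  -- Three horizontal products are negative while the inner products are positive, so all heights
  -- have the same sign, and `hz` excludes the negative one.
  have zp : 0 < z₁ ∧ 0 < z₂ := by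
    rcases pos_and_pos_or_neg_and_neg_of_mul_pos z23 with ⟨ha, hb⟩ | ⟨ha, hb⟩
    · exact ⟨(pos_iff_pos_of_mul_pos z41).1 ((pos_iff_pos_of_mul_pos z34).1 hb), ha⟩
    · exact absurd ⟨(neg_iff_neg_of_mul_pos z41).1 ((neg_iff_neg_of_mul_pos z34).1 hb), ha, hb,
        (neg_iff_neg_of_mul_pos z34).1 hb⟩ hz
  obtain ⟨zp1, zp2⟩ := zp
  have h8 : √8 = 2 * √2 := by
    rw [show (8 : ℝ) = 2 ^ 2 * 2 by norm_num, Real.sqrt_mul (by norm_num), Real.sqrt_sq (by norm_num)]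
  have h2 : √2 ^ 2 = 2 := Real.sq_sqrt (by norm_num)
  have hl : (1.4142 : ℝ) ≤ √2 := by apply Real.le_sqrt_of_sq_le; norm_num
  rw [h8] at hq₁ hq₂ hq₃ hq₄
  have zu1 : z₁ < 2 * √2 := lt_of_pow_lt_pow_left₀ 2 (by positivity)
    (by rw [mul_pow, h2]; linarith [sq_nonneg r1])
  have zu2 : z₂ < 2 * √2 := lt_of_pow_lt_pow_left₀ 2 (by positivity)
    (by rw [mul_pow, h2]; linarith [sq_nonneg r2])
  -- Heights are measured from √2, the midpoint between the ball centres at heights 0 and √8.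
  have key : ∀ {r s y x : ℝ}, 0 < y → y < 2 * √2 → 4 ≤ r ^ 2 + y ^ 2 → 4 ≤ s ^ 2 + x ^ 2 →
      4 ≤ r ^ 2 + (y - 2 * √2) ^ 2 → 4 ≤ s ^ 2 + (x - 2 * √2) ^ 2 →
      4 + 2 * √2 * |y - √2| ≤ r ^ 2 + s ^ 2 + (y - x) ^ 2 := by
    intro r s y x hy hy' a1 a2 a3 a4
    have := four_add_le_of_outside (r := r ^ 2) (s := s ^ 2) (y := y - √2) (x := x - √2)
      (by rw [abs_le]; constructor <;> linarith) (by ring_nf; ring_nf at a1; linarith)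
      (by ring_nf; ring_nf at a3; linarith) (by ring_nf; ring_nf at a2; linarith)
      (by ring_nf; ring_nf at a4; linarith)
    calc _ ≤ _ := this
      _ = _ := by ring
  have k1 := key zp1 zu1 ho₁ ho₄ hq₁ hq₄
  have k2 := key zp2 zu2 ho₂ ho₃ hq₂ hq₃
  have q1 : 2 * √2 * |z₁ - √2| + 4 * -C4 ≤ 2.8121 := by
    rw [show (z₁ - z₄) ^ 2 = (z₄ - z₁) ^ 2 by ring] at k1; linarith
  have q2 : 2 * √2 * |z₂ - √2| + 4 * -C2 ≤ 2.8121 := by linarith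
  -- The two edges next to the backward one force both its ends close to height √2 and, by `hr`,
  -- bound its horizontal part: its squared length is below 3 + 0.979, against `h12`.
  have hy2 := sub_sq_le_of_abs_le hl q1 q2 (by linarith)
  rw [sub_sub_sub_cancel_right] at hy2
  have hr := sq_add_sq_sub_lt n1 n2 hw₁ hw₂ (by linarith [sq_nonneg (z₄ - z₁)])
    (by linarith [sq_nonneg (z₂ - z₃)])
  have x1' : r1 * r2 * (√2 / 2) ≤ x1 := by
    rw [e1]; exact mul_le_mul_of_nonneg_left c1 (mul_nonneg n1 n2)
  have := mul_le_mul_of_nonneg_left hl (mul_nonneg n1 n2)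
  linarith

/-! ### Turning angles and radii about an axis -/

/-- The coordinate along the axis spanned by `q`. -/
noncomputable def height (q a : R3) : ℝ := inner ℝ q a / ‖q‖

/-- `w` is the projection along `q` to the orthogonal plane, identified with the complex plane. -/
def IsCylindrical (q : R3) (w : R3 →ₗ[ℝ] ℂ) : Prop :=
  (∀ a b, inner ℝ a b = height q a * height q b + (conj (w a) * w b).re) ∧
    ∀ a b, triple q a b = ‖q‖ * (conj (w a) * w b).im

theorem exists_isCylindrical {q : R3} (hq : q ≠ 0) : ∃ w, IsCylindrical q w :=
  exists_cylindrical q hq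

theorem conj_mul_self_re (a : ℂ) : (conj a * a).re = ‖a‖ ^ 2 := by
  rw [← Complex.normSq_eq_norm_sq, Complex.normSq_apply]; simp

namespace IsCylindrical

variable {q : R3} {w : R3 →ₗ[ℝ] ℂ}

theorem norm_sq (hw : IsCylindrical q w) (a : R3) : ‖a‖ ^ 2 = ‖w a‖ ^ 2 + height q a ^ 2 := by
  rw [← real_inner_self_eq_norm_sq, hw.1, conj_mul_self_re]; ring

theorem dist_sq (hw : IsCylindrical q w) (a b : R3) :
    dist a b ^ 2 = ‖w a - w b‖ ^ 2 + (height q a - height q b) ^ 2 := by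
  rw [dist_eq_norm, hw.norm_sq, map_sub]
  simp [height, inner_sub_right, sub_div]

theorem map_axis (hw : IsCylindrical q w) (hq : q ≠ 0) : w q = 0 := by
  have h := hw.norm_sq q
  have hn : ‖q‖ ≠ 0 := norm_ne_zero_iff.2 hq
  rw [height, real_inner_self_eq_norm_sq, pow_two ‖q‖, mul_div_cancel_right₀ _ hn] at h
  have : ‖w q‖ ^ 2 = 0 := by linarith
  simpa using this

theorem triple_pos_iff (hw : IsCylindrical q w) (hq : q ≠ 0) {a b : R3} :
    0 < triple q a b ↔ 0 < (conj (w a) * w b).im := by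
  rw [hw.2, mul_pos_iff_of_pos_left (norm_pos_iff.2 hq)]

end IsCylindrical

theorem conj_mul_mul_conj_mul (a b c : ℂ) :
    conj a * b * (conj b * c) = ((‖b‖ ^ 2 : ℝ) : ℂ) * (conj a * c) := by
  rw [← Complex.normSq_eq_norm_sq, ← Complex.mul_conj]; ring

theorem re_conj_mul_trans (a b c : ℂ) : ‖b‖ ^ 2 * (conj a * c).re =
    ‖b‖ ^ 2 * (‖a‖ * ‖c‖ * Real.cos (Complex.arg (conj a * b) + Complex.arg (conj b * c))) := by
  have h := congrArg Complex.re (conj_mul_mul_conj_mul a b c)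
  rw [Complex.re_ofReal_mul, Complex.mul_re, re_conj_mul_eq a b, re_conj_mul_eq b c,
    im_conj_mul_eq a b, im_conj_mul_eq b c] at h
  rw [← h, Real.cos_add]; ring

theorem im_conj_mul_trans (a b c : ℂ) : ‖b‖ ^ 2 * (conj a * c).im =
    ‖b‖ ^ 2 * (‖a‖ * ‖c‖ * Real.sin (Complex.arg (conj a * b) + Complex.arg (conj b * c))) := by
  have h := congrArg Complex.im (conj_mul_mul_conj_mul a b c)
  rw [Complex.im_ofReal_mul, Complex.mul_im, re_conj_mul_eq a b, re_conj_mul_eq b c,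
    im_conj_mul_eq a b, im_conj_mul_eq b c] at h
  rw [← h, Real.sin_add]; ring

theorem re_conj_mul_eq_cos {a b c : ℂ} (hb : b ≠ 0) : (conj a * c).re =
    ‖a‖ * ‖c‖ * Real.cos (Complex.arg (conj a * b) + Complex.arg (conj b * c)) :=
  mul_left_cancel₀ (by positivity) (re_conj_mul_trans a b c)

theorem im_conj_mul_eq_sin {a b c : ℂ} (hb : b ≠ 0) : (conj a * c).im =
    ‖a‖ * ‖c‖ * Real.sin (Complex.arg (conj a * b) + Complex.arg (conj b * c)) :=
  mul_left_cancel₀ (by positivity) (im_conj_mul_trans a b c)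

theorem fin_four_add_add (i : Fin 4) : i + 1 + 1 = i + 2 ∧ i + 2 + 1 = i + 3 ∧ i + 3 + 1 = i := by
  fin_cases i <;> exact ⟨rfl, rfl, rfl⟩

theorem fin_four_cases {P : Fin 4 → Prop} (i : Fin 4) (h0 : P i) (h1 : P (i + 1))
    (h2 : P (i + 2)) (h3 : P (i + 3)) : ∀ j, P j := by
  intro j
  fin_cases i <;> fin_cases j <;> assumption

theorem sum_fin_four (f : Fin 4 → ℝ) (i : Fin 4) :
    ∑ j, f j = f i + f (i + 1) + f (i + 2) + f (i + 3) := by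
  rw [Fin.sum_univ_four]
  fin_cases i
  · rfl
  · change _ = f 1 + f 2 + f 3 + f 0; ring
  · change _ = f 2 + f 3 + f 0 + f 1; ring
  · change _ = f 3 + f 0 + f 1 + f 2; ring

/-- The angles between consecutive points around the axis add up to a multiple of `2π`. -/
theorem exists_int_sum_arg {w : Fin 4 → ℂ} (hw : ∀ i, w i ≠ 0) :
    ∃ n : ℤ, ∑ i, Complex.arg (conj (w i) * w (i + 1)) = 2 * pi * n := by
  have hne : ∀ i j, conj (w i) * w j ≠ 0 := fun i j =>
    mul_ne_zero ((map_ne_zero _).2 (hw i)) (hw j)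
  have h : ((∑ i, Complex.arg (conj (w i) * w (i + 1)) : ℝ) : Real.Angle) = (0 : ℝ) := by
    rw [Fin.sum_univ_four]
    change ((Complex.arg (conj (w 0) * w 1) + Complex.arg (conj (w 1) * w 2) +
      Complex.arg (conj (w 2) * w 3) + Complex.arg (conj (w 3) * w 0) : ℝ) : Real.Angle) = _
    rw [Real.Angle.coe_add, Real.Angle.coe_add, Real.Angle.coe_add,
      ← Complex.arg_mul_coe_angle (hne 0 1) (hne 1 2),
      ← Complex.arg_mul_coe_angle (mul_ne_zero (hne 0 1) (hne 1 2)) (hne 2 3),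
      ← Complex.arg_mul_coe_angle (mul_ne_zero (mul_ne_zero (hne 0 1) (hne 1 2)) (hne 2 3))
        (hne 3 0)]
    have e : conj (w 0) * w 1 * (conj (w 1) * w 2) * (conj (w 2) * w 3) * (conj (w 3) * w 0) =
        ((‖w 0‖ ^ 2 * ‖w 1‖ ^ 2 * ‖w 2‖ ^ 2 * ‖w 3‖ ^ 2 : ℝ) : ℂ) := by
      simp only [← Complex.normSq_eq_norm_sq, Complex.ofReal_mul, ← Complex.mul_conj]
      ring
    rw [e, Complex.arg_ofReal_of_nonneg (by positivity)]
  obtain ⟨k, hk⟩ := Real.Angle.angle_eq_iff_two_pi_dvd_sub.1 h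
  exact ⟨k, by linarith⟩

/-- A direction that is on the positive side of the three planes spanned by the origin and two of
three vectors lies in the cone of these vectors. -/
theorem mem_cone_of_triple {x y z q u : R3} (hx : 0 < inner ℝ u x) (hy : 0 < inner ℝ u y)
    (hz : 0 < inner ℝ u z) (hq : 0 ≤ inner ℝ u q) (h1 : 0 ≤ triple q y z)
    (h2 : 0 ≤ triple q z x) (h3 : 0 < triple q x y) :
    0 < triple x y z ∧ q = (triple q y z / triple x y z) • x + (triple q z x / triple x y z) • y +
      (triple q x y / triple x y z) • z := by
  have h := triple_cramer x y z q
  have hu := congrArg (inner ℝ u) h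
  simp only [inner_add_right, real_inner_smul_right] at hu
  have hpos : 0 < triple x y z := by
    by_contra hc
    push Not at hc
    have := mul_nonneg h1 hx.le
    have := mul_nonneg h2 hy.le
    have := mul_pos h3 hz
    have := mul_nonpos_of_nonpos_of_nonneg hc hq
    linarith
  refine ⟨hpos, ?_⟩
  rw [div_eq_inv_mul, div_eq_inv_mul, div_eq_inv_mul, mul_smul, mul_smul, mul_smul, ← smul_add,
    ← smul_add, ← h, smul_smul, inv_mul_cancel₀ hpos.ne', one_smul]

theorem exists_pos_functional {p : Fin 4 → R3} {q : R3} (hp : IsFrame p) (hd : InDualCone p q) :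
    ∃ u : R3, (∀ i, 0 < inner ℝ u (p i)) ∧ 0 ≤ inner ℝ u q := by
  obtain ⟨u, hu⟩ := hp.exists_hemisphere
  exact ⟨u, hu, hd u hu⟩

namespace IsAxis

variable {p : Fin 4 → R3} {q : R3} {w : R3 →ₗ[ℝ] ℂ}

theorem ne_zero (hq : IsAxis p q) : q ≠ 0 := by
  rintro rfl
  have := hq.two_le_norm
  simp at this
  linarith

theorem four_le_outer (hp : IsFrame p) (hq : IsAxis p q) (hw : IsCylindrical q w) (i : Fin 4) :
    4 ≤ ‖w (p i)‖ ^ 2 + (height q (p i) - √8) ^ 2 := by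
  have hn : 0 < ‖q‖ := norm_pos_iff.2 hq.ne_zero
  have ht : 1 ≤ √8 / ‖q‖ := by rw [le_div_iff₀ hn]; linarith [hq.norm_le]
  have h := (hq.two_le_dist i).trans
    (dist_le_dist_smul ht hq.two_le_norm (hp.norm_lt i).le (hq.two_le_dist i))
  have h2 := hw.dist_sq (p i) ((√8 / ‖q‖) • q)
  rw [map_smul, hw.map_axis hq.ne_zero, smul_zero, sub_zero,
    show height q ((√8 / ‖q‖) • q) = √8 by
      rw [height, real_inner_smul_right, real_inner_self_eq_norm_sq]; field_simp] at h2
  rw [← h2]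
  nlinarith

theorem norm_sq_bounds (hp : IsFrame p) (hw : IsCylindrical q w) (i : Fin 4) :
    4 ≤ ‖w (p i)‖ ^ 2 + height q (p i) ^ 2 ∧ ‖w (p i)‖ ^ 2 + height q (p i) ^ 2 < 8 := by
  rw [← hw.norm_sq]
  exact ⟨four_le_norm_sq (hp.two_le_norm i), norm_sq_lt (hp.norm_lt i)⟩

theorem edge_sq_le (hp : IsFrame p) (hw : IsCylindrical q w) (i : Fin 4) :
    ‖w (p i) - w (p (i + 1))‖ ^ 2 + (height q (p i) - height q (p (i + 1))) ^ 2 ≤ 6.8121 := by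
  rw [← hw.dist_sq]
  nlinarith [hp.dist_le i, dist_nonneg (x := p i) (y := p (i + 1))]

/-- The angle between `p i` and `q` is less than 3π/4. At height at most 0 this puts more than half
of ‖p i‖² into the horizontal part. At positive height, the point is outside the balls of radius 2
about the axis points at heights 0 and √8, and a radius below √2 would put it into one of them or
beyond height 3√2. -/
theorem radius_of_mem_cone (hp : IsFrame p) (hq : IsAxis p q) (hw : IsCylindrical q w)
    {i j k : Fin 4} {α β γ : ℝ} (hα : 0 ≤ α) (hβ : 0 ≤ β) (hγ : 0 ≤ γ)
    (h : q = α • p i + β • p j + γ • p k) (hij : dist (p i) (p j) ≤ 2.61)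
    (hjk : dist (p j) (p k) ≤ 2.61) : 2 ≤ ‖w (p i)‖ ^ 2 := by
  have h1 := neg_lt_inner_of_mem_cone hα hβ hγ h (hp.two_le_norm i) (hp.two_le_norm j)
    (hp.two_le_norm k) (hp.norm_lt k).le hq.two_le_norm hq.norm_le hij hjk (hq.two_le_dist k)
  have h2 := hq.four_le_outer hp hw i
  have h3 := norm_sq_bounds (q := q) hp hw i
  have hn : 0 < ‖q‖ := norm_pos_iff.2 hq.ne_zero
  have h4 : -(√2 / 2 * ‖p i‖) < height q (p i) := by
    rw [height, lt_div_iff₀ hn, real_inner_comm]; linarith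
  have h5 := hw.norm_sq (p i)
  have h8 : √8 = 2 * √2 := by
    rw [show (8 : ℝ) = 2 ^ 2 * 2 by norm_num, Real.sqrt_mul (by norm_num),
      Real.sqrt_sq (by norm_num)]
  have hs : √2 ^ 2 = 2 := Real.sq_sqrt (by norm_num)
  have hs0 : 0 < √2 := by positivity
  rw [h8] at h2
  generalize height q (p i) = z at *
  generalize √2 = s at *
  have hw0 := sq_nonneg ‖w (p i)‖
  have hn0 := norm_nonneg (p i)
  by_contra hc
  push Not at hc
  rcases le_or_gt z 0 with hz | hz
  · have : z ^ 2 < (s / 2 * ‖p i‖) ^ 2 := by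
      apply sq_lt_sq' h4
      have : 0 < s / 2 * ‖p i‖ := by linarith
      linarith
    rw [mul_pow, div_pow, hs] at this
    linarith
  · have hz1 : s < z := by nlinarith
    have hz2 : z < 3 * s := by nlinarith
    nlinarith

/-- If the quadrilateral winds once around the axis, none of its edges turns backwards. -/
theorem arg_pos_of_sum (hp : IsFrame p) (hq : IsAxis p q) (hd : InDualCone p q)
    (hw : IsCylindrical q w) (hr : ∀ i, 2 ≤ ‖w (p i)‖ ^ 2)
    (hs : ∑ i, Complex.arg (conj (w (p i)) * w (p (i + 1))) = 2 * pi) (i : Fin 4) :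
    0 < Complex.arg (conj (w (p i)) * w (p (i + 1))) := by
  obtain ⟨e1, e2, e3⟩ := fin_four_add_add i
  rw [sum_fin_four _ i, e1, e2, e3] at hs
  have i1 := hp.inner_pos (i + 1)
  have i2 := hp.inner_pos (i + 2)
  have i3 := hp.inner_pos (i + 3)
  rw [hw.1] at i1 i2 i3
  have d0 := hw.dist_sq (p i) (p (i + 1))
  have d0' : 2 ≤ dist (p i) (p (i + 1)) := hp.two_le_dist _ _ (by fin_cases i <;> decide)
  have d1 := edge_sq_le (q := q) hp hw (i + 1)
  have d2 := edge_sq_le (q := q) hp hw (i + 2)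
  have d3 := edge_sq_le (q := q) hp hw (i + 3)
  rw [e1] at i1 d1
  rw [e2] at i2 d2
  rw [e3] at i3 d3
  refine not_backward (hr _) (hr _) (hr _) (hr _) (norm_sq_bounds (q := q) hp hw _).2
    (norm_sq_bounds (q := q) hp hw _).2 (norm_sq_bounds (q := q) hp hw _).1
    (norm_sq_bounds (q := q) hp hw _).1 (norm_sq_bounds (q := q) hp hw _).1
    (norm_sq_bounds (q := q) hp hw _).1 (hq.four_le_outer hp hw _) (hq.four_le_outer hp hw _)
    (hq.four_le_outer hp hw _) (hq.four_le_outer hp hw _) (by rw [← d0]; nlinarith) d1 d2 d3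
    i1 i2 i3 ?_ hs
  -- If all heights were negative, -q would be positive on every vertex, and the dual cone condition
  -- would give -‖q‖² ≥ 0.
  rintro ⟨h0, h1, h2, h3⟩
  have hn : 0 < ‖q‖ := norm_pos_iff.2 hq.ne_zero
  have hneg : ∀ j, 0 < inner ℝ (-q) (p j) := by
    have aux : ∀ j, height q (p j) < 0 → 0 < inner ℝ (-q) (p j) := by
      intro j hj
      rw [height, div_neg_iff] at hj
      rw [inner_neg_left]
      rcases hj with hj | hj <;> linarith
    exact fin_four_cases i (aux _ h0) (aux _ h1) (aux _ h2) (aux _ h3)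
  have := hd (-q) hneg
  rw [inner_neg_left, real_inner_self_eq_norm_sq] at this
  nlinarith

theorem arg_lt_of_radius (hp : IsFrame p) (hw : IsCylindrical q w)
    (hr : ∀ i, 2 ≤ ‖w (p i)‖ ^ 2) (i : Fin 4) :
    |Complex.arg (conj (w (p i)) * w (p (i + 1)))| < 3 * pi / 4 :=
  arg_le_of_close (hr _) (hr _)
    (by nlinarith [edge_sq_le (q := q) hp hw i, sq_nonneg (height q (p i) - height q (p (i + 1)))])

theorem triple_pos_of_arg (hq : IsAxis p q) (hw : IsCylindrical q w) {i j : Fin 4}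
    (hi : w (p i) ≠ 0) (hj : w (p j) ≠ 0) (h0 : 0 < Complex.arg (conj (w (p i)) * w (p j)))
    (h1 : Complex.arg (conj (w (p i)) * w (p j)) < pi) : 0 < triple q (p i) (p j) := by
  rw [hw.triple_pos_iff hq.ne_zero, im_conj_mul_eq]
  have := Real.sin_pos_of_pos_of_lt_pi h0 h1
  positivity

theorem triple_pos_of_arg_add (hq : IsAxis p q) (hw : IsCylindrical q w) {i j k : Fin 4}
    (hi : w (p i) ≠ 0) (hj : w (p j) ≠ 0) (hk : w (p k) ≠ 0)
    (h0 : pi < Complex.arg (conj (w (p i)) * w (p j)) + Complex.arg (conj (w (p j)) * w (p k)))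
    (h1 : Complex.arg (conj (w (p i)) * w (p j)) + Complex.arg (conj (w (p j)) * w (p k)) < 2 * pi) :
    0 < triple q (p k) (p i) := by
  rw [triple_swap, neg_pos, hw.2, im_conj_mul_eq_sin hj]
  have hs : Real.sin (Complex.arg (conj (w (p i)) * w (p j)) +
      Complex.arg (conj (w (p j)) * w (p k))) < 0 := by
    rw [← neg_pos, ← Real.sin_sub_pi]
    exact Real.sin_pos_of_pos_of_lt_pi (by linarith) (by linarith)
  have hn : 0 < ‖q‖ := norm_pos_iff.2 hq.ne_zero
  have : 0 < ‖q‖ * (‖w (p i)‖ * ‖w (p k)‖) := by positivity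
  nlinarith

end IsAxis

/-! ### Encircling as a sign condition -/

/-- The quadrilateral `p` winds counterclockwise around the half-line through `q`. -/
structure Encircles (p : Fin 4 → R3) (q : R3) : Prop where
  triple_pos : ∀ i, 0 < triple q (p i) (p (i + 1))
  dual : InDualCone p q

namespace IsAxis

variable {p : Fin 4 → R3} {q : R3} {w : R3 →ₗ[ℝ] ℂ}

theorem two_le_radius_sq_of_cone (hp : IsFrame p) (hq : IsAxis p q) (hd : InDualCone p q)
    (hw : IsCylindrical q w) {i : Fin 4} (h0 : 0 < triple q (p i) (p (i + 1)))
    (h1 : 0 ≤ triple q (p (i + 1)) (p (i + 2))) (h2 : 0 ≤ triple q (p (i + 2)) (p i)) :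
    2 ≤ ‖w (p i)‖ ^ 2 ∧ 2 ≤ ‖w (p (i + 2))‖ ^ 2 := by
  obtain ⟨u, hu, huq⟩ := exists_pos_functional hp hd
  obtain ⟨ht, h⟩ := mem_cone_of_triple (hu i) (hu (i + 1)) (hu (i + 2)) huq h1 h2 h0
  have e := hp.dist_le i
  have e' := hp.dist_le (i + 1)
  rw [(fin_four_add_add i).1] at e'
  have n0 := div_nonneg h1 ht.le
  have n1 := div_nonneg h2 ht.le
  have n2 := div_nonneg h0.le ht.le
  refine ⟨radius_of_mem_cone hp hq hw n0 n1 n2 h e e', ?_⟩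
  rw [dist_comm] at e e'
  exact radius_of_mem_cone hp hq hw n2 n1 n0 (h.trans (by abel)) e' e

/-- The diagonal from `p i` to `p (i + 2)` cuts the quadrilateral into two triangles, both with
vertex `p i`; the direction of `q` lies in one of them. -/
theorem two_le_radius_sq (hp : IsFrame p) (hq : IsAxis p q) (hw : IsCylindrical q w)
    (he : Encircles p q) (i : Fin 4) : 2 ≤ ‖w (p i)‖ ^ 2 := by
  obtain ⟨e1, e2, e3⟩ := fin_four_add_add i
  have t1 := he.triple_pos (i + 1)
  have t2 := he.triple_pos (i + 2)
  have t3 := he.triple_pos (i + 3)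
  rw [e1] at t1
  rw [e2] at t2
  rw [e3] at t3
  rcases le_or_gt 0 (triple q (p (i + 2)) (p i)) with h | h
  · exact (two_le_radius_sq_of_cone hp hq he.dual hw (he.triple_pos i) t1.le h).1
  · have h' := two_le_radius_sq_of_cone (i := i + 2) hp hq he.dual hw
    rw [e2, show i + 2 + 2 = i by fin_cases i <;> rfl] at h'
    refine (h' t2 t3.le ?_).2
    rw [triple_swap]; linarith

/-- If one edge does not turn forwards, the other three turn by less than π each and by at least 2π
together. Hence any two consecutive ones of these turn by more than π, so `q` lies in the cones of
two triangles that together use all four vertices. This supplies the radius bounds needed to exclude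
a backward edge. -/
theorem encircles_of_sum_arg (hp : IsFrame p) (hq : IsAxis p q) (hd : InDualCone p q)
    (hw : IsCylindrical q w) (h0 : ∀ i, w (p i) ≠ 0)
    (hlt : ∀ i, Complex.arg (conj (w (p i)) * w (p (i + 1))) < pi)
    (hs : ∑ i, Complex.arg (conj (w (p i)) * w (p (i + 1))) = 2 * pi) : Encircles p q := by
  suffices h : ∀ i, 0 < Complex.arg (conj (w (p i)) * w (p (i + 1))) from
    ⟨fun i => triple_pos_of_arg hq hw (h0 _) (h0 _) (h i) (hlt i), hd⟩
  by_contra hc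
  push Not at hc
  obtain ⟨i, hi⟩ := hc
  refine hi.not_gt (arg_pos_of_sum hp hq hd hw ?_ hs i)
  obtain ⟨e1, e2, e3⟩ := fin_four_add_add i
  rw [sum_fin_four _ i, e1, e2, e3] at hs
  have l1 := hlt (i + 1)
  have l2 := hlt (i + 2)
  have l3 := hlt (i + 3)
  rw [e1] at l1
  rw [e2] at l2
  rw [e3] at l3
  have t1 := triple_pos_of_arg hq hw (h0 (i + 1)) (h0 (i + 2)) (by linarith) l1
  have t2 := triple_pos_of_arg hq hw (h0 (i + 2)) (h0 (i + 3)) (by linarith) l2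
  have t3 := triple_pos_of_arg hq hw (h0 (i + 3)) (h0 i) (by linarith) l3
  have s1 := triple_pos_of_arg_add hq hw (h0 (i + 1)) (h0 (i + 2)) (h0 (i + 3)) (by linarith)
    (by linarith)
  have s2 := triple_pos_of_arg_add hq hw (h0 (i + 2)) (h0 (i + 3)) (h0 i) (by linarith)
    (by linarith)
  have a := two_le_radius_sq_of_cone (i := i + 1) hp hq hd hw
  have b := two_le_radius_sq_of_cone (i := i + 2) hp hq hd hw
  rw [e1, show i + 1 + 2 = i + 3 by fin_cases i <;> rfl] at a
  rw [e2, show i + 2 + 2 = i by fin_cases i <;> rfl] at b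
  have a' := a t1 t2.le s1.le
  have b' := b t2 t3.le s2.le
  exact fin_four_cases i b'.2 a'.1 b'.1 a'.2

theorem ne_zero_of_radius {a : ℂ} (h : 2 ≤ ‖a‖ ^ 2) : a ≠ 0 := by
  rintro rfl
  norm_num at h

theorem sum_arg_eq (hp : IsFrame p) (hw : IsCylindrical q w) (hr : ∀ i, 2 ≤ ‖w (p i)‖ ^ 2)
    (h : ∀ i, 0 ≤ Complex.arg (conj (w (p i)) * w (p (i + 1)))) :
    ∑ i, Complex.arg (conj (w (p i)) * w (p (i + 1))) = 0 ∨
      ∑ i, Complex.arg (conj (w (p i)) * w (p (i + 1))) = 2 * pi := by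
  obtain ⟨n, hn⟩ := exists_int_sum_arg (w := fun i => w (p i)) fun i => ne_zero_of_radius (hr i)
  have hl := fun i => (abs_lt.1 (arg_lt_of_radius hp hw hr i)).2
  rw [hn]
  rw [Fin.sum_univ_four] at hn
  have hpi := Real.pi_pos
  have b1 : (n : ℝ) < 2 := by
    by_contra hc
    push Not at hc
    nlinarith [hl 0, hl 1, hl 2, hl 3]
  have b2 : (-1 : ℝ) < n := by
    by_contra hc
    push Not at hc
    nlinarith [h 0, h 1, h 2, h 3]
  have c1 : n < 2 := by exact_mod_cast b1
  have c2 : -1 < n := by exact_mod_cast b2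
  obtain rfl | rfl : n = 0 ∨ n = 1 := by omega
  · simp
  · simp

/-- This gives closedness: a total turning of 0 would put all vertices in one half-plane bounded by
the axis, contradicting the dual cone condition; otherwise the total is 2π. -/
theorem encircles_of_nonneg (hp : IsFrame p) (hq : IsAxis p q) (hd : InDualCone p q)
    (hw : IsCylindrical q w) (hr : ∀ i, 2 ≤ ‖w (p i)‖ ^ 2)
    (h : ∀ i, 0 ≤ triple q (p i) (p (i + 1))) : Encircles p q := by
  have hn : 0 < ‖q‖ := norm_pos_iff.2 hq.ne_zero
  have ha : ∀ i, 0 ≤ Complex.arg (conj (w (p i)) * w (p (i + 1))) := by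
    intro i
    rw [Complex.arg_nonneg_iff]
    have := h i
    rw [hw.2] at this
    exact nonneg_of_mul_nonneg_right this hn
  have h0 := fun i => ne_zero_of_radius (hr i)
  rcases sum_arg_eq hp hw hr ha with hs | hs
  · exfalso
    have hz : ∀ i, Complex.arg (conj (w (p i)) * w (p (i + 1))) = 0 := fun i =>
      (Finset.sum_eq_zero_iff_of_nonneg (fun i _ => ha i)).1 hs i (Finset.mem_univ i)
    have hre : ∀ i, 2 ≤ (conj (w (p 0)) * w (p i)).re := by
      have key : ∀ i, (conj (w (p 0)) * w (p i)).re = ‖w (p 0)‖ * ‖w (p i)‖ →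
          2 ≤ (conj (w (p 0)) * w (p i)).re := by
        intro i hi
        rw [hi]
        nlinarith [hr 0, hr i, two_le_mul_of_sq (norm_nonneg _) (norm_nonneg _) (hr 0) (hr i)]
      have z0 := hz 0
      have z1 := hz 1
      have z3 := hz 3
      change Complex.arg (conj (w (p 0)) * w (p 1)) = 0 at z0
      change Complex.arg (conj (w (p 1)) * w (p 2)) = 0 at z1
      change Complex.arg (conj (w (p 3)) * w (p 0)) = 0 at z3
      refine fin_four_cases 0 (key _ ?_) (key _ ?_) (key _ ?_) (key _ ?_)
      · rw [conj_mul_self_re, pow_two]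
      · change (conj (w (p 0)) * w (p 1)).re = ‖w (p 0)‖ * ‖w (p 1)‖
        rw [re_conj_mul_eq, z0]; simp
      · change (conj (w (p 0)) * w (p 2)).re = ‖w (p 0)‖ * ‖w (p 2)‖
        rw [re_conj_mul_eq_cos (h0 1), z0, z1]; simp
      · change (conj (w (p 0)) * w (p 3)).re = ‖w (p 0)‖ * ‖w (p 3)‖
        have : (conj (w (p 0)) * w (p 3)).re = (conj (w (p 3)) * w (p 0)).re := by simp; ring
        rw [this, re_conj_mul_eq, z3]; simp [mul_comm]
    -- The horizontal part of `p 0`, tilted by -q/8. On each vertex it is at least 2 - 8/8, on `q`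
    -- it is -‖q‖²/8.
    have := hd (p 0 - (height q (p 0) / ‖q‖ + 1 / 8) • q) (fun i => by
      have e : height q (p 0) / ‖q‖ * inner ℝ q (p i) = height q (p 0) * height q (p i) := by
        simp only [height]; ring
      have hi := hre i
      have h1 := hw.1 (p 0) (p i)
      have h2 : inner ℝ q (p i) ≤ 8 := by
        have := norm_sq_lt (hp.norm_lt i)
        have := norm_sq_le hq.norm_le
        have := real_inner_le_norm q (p i)
        nlinarith [sq_nonneg (‖q‖ - ‖p i‖)]
      rw [inner_sub_left, real_inner_smul_left, add_mul, e]
      linarith)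
    rw [inner_sub_left, real_inner_smul_left, real_inner_self_eq_norm_sq, height,
      real_inner_comm] at this
    have e : (inner ℝ q (p 0) / ‖q‖ / ‖q‖ + 1 / 8) * ‖q‖ ^ 2 = inner ℝ q (p 0) + ‖q‖ ^ 2 / 8 := by
      field_simp
    rw [e] at this
    nlinarith
  · exact encircles_of_sum_arg hp hq hd hw h0
      (fun i => by have := (abs_lt.1 (arg_lt_of_radius hp hw hr i)).2; linarith [Real.pi_pos]) hs

theorem arg_pos_of_triple (hq : IsAxis p q) (hw : IsCylindrical q w) {a b : R3}
    (h : 0 < triple q a b) :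
    0 < Complex.arg (conj (w a) * w b) ∧ Complex.arg (conj (w a) * w b) < pi := by
  have h1 := (hw.triple_pos_iff hq.ne_zero).1 h
  refine ⟨lt_of_le_of_ne (Complex.arg_nonneg_iff.2 h1.le) fun h2 => ?_,
    Complex.arg_lt_pi_iff.2 (Or.inr h1.ne')⟩
  rw [eq_comm, Complex.arg_eq_zero_iff] at h2
  exact h1.ne' h2.2

theorem arg_of_encircles (hp : IsFrame p) (hq : IsAxis p q) (hw : IsCylindrical q w)
    (he : Encircles p q) : (∀ i, 0 < Complex.arg (conj (w (p i)) * w (p (i + 1))) ∧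
      Complex.arg (conj (w (p i)) * w (p (i + 1))) < 3 * pi / 4) ∧
      ∑ i, Complex.arg (conj (w (p i)) * w (p (i + 1))) = 2 * pi := by
  have hr := two_le_radius_sq hp hq hw he
  have ha := fun i => (arg_pos_of_triple hq hw (he.triple_pos i)).1
  refine ⟨fun i => ⟨ha i, (abs_lt.1 (arg_lt_of_radius hp hw hr i)).2⟩, ?_⟩
  refine (sum_arg_eq hp hw hr fun i => (ha i).le).resolve_left fun h => ?_
  exact (Finset.sum_pos (fun i _ => ha i) Finset.univ_nonempty).ne' h

theorem re_opposite_neg (hp : IsFrame p) (hq : IsAxis p q) (hw : IsCylindrical q w)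
    (he : Encircles p q) (i : Fin 4) : (conj (w (p i)) * w (p (i + 2))).re < 0 := by
  obtain ⟨e1, e2, e3⟩ := fin_four_add_add i
  have hr := two_le_radius_sq hp hq hw he
  obtain ⟨ha, hs⟩ := arg_of_encircles hp hq hw he
  have h0 := fun i => norm_pos_iff.2 (ne_zero_of_radius (hr i))
  rw [sum_fin_four _ i] at hs
  rw [re_conj_mul_eq_cos (norm_pos_iff.1 (h0 (i + 1)))]
  have a1 := ha (i + 1)
  rw [e1] at a1 hs
  have : Real.cos (Complex.arg (conj (w (p i)) * w (p (i + 1))) +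
      Complex.arg (conj (w (p (i + 1))) * w (p (i + 2)))) < 0 := by
    apply Real.cos_neg_of_pi_div_two_lt_of_lt
    · linarith [(ha (i + 2)).2, (ha (i + 3)).2]
    · linarith [(ha i).2, a1.2]
  exact mul_neg_of_pos_of_neg (mul_pos (h0 _) (h0 _)) this

/-- Two consecutive turning angles add up to strictly between π/2 and 3π/2, and both radii are at
least √2. The strict inequality is what lets a single vertex move without regard to its opposite. -/
theorem two_lt_dist_opposite (hp : IsFrame p) (hq : IsAxis p q) (he : Encircles p q)
    (i : Fin 4) : 2 < dist (p i) (p (i + 2)) := by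
  obtain ⟨w, hw⟩ := exists_isCylindrical hq.ne_zero
  have hr := two_le_radius_sq hp hq hw he
  have h1 := re_opposite_neg hp hq hw he i
  have h2 := hw.dist_sq (p i) (p (i + 2))
  rw [norm_sub_sq_complex] at h2
  nlinarith [hr i, hr (i + 2), sq_nonneg (height q (p i) - height q (p (i + 2))),
    dist_nonneg (x := p i) (y := p (i + 2))]

end IsAxis

/-! ### The plane of a corner separates the axis point from the origin -/

/-- To be read with σ = ‖p i‖², ℓ = ‖q‖², m = ⟪p i, q⟫. The conclusion places `p i` at height m/√ℓ ≥
0 and at squared distance at least 4 from the axis. -/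
theorem radon_bounds {σ ℓ m u c P : ℝ} (hu : 0 < u) (hu1 : u < 1) (hc : c ≤ 1)
    (hP : P ≤ c * σ) (h1 : 4 ≤ ℓ - 2 * ((1 - u) * ℓ + u * m) + P)
    (h2 : 4 ≤ σ - 2 * ((1 - u) * m + u * σ) + P) (hd : σ - 2 * m + ℓ ≤ 8)
    (hσ : 4 ≤ σ) (hσ' : σ < 8) (hℓ : 4 ≤ ℓ) : 0 ≤ m ∧ m ≤ σ - 4 ∧ ℓ ≤ σ := by
  have hP' : P ≤ σ := by nlinarith
  have hm : m ≤ ℓ := by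
    by_contra hc
    push Not at hc
    nlinarith
  have hm' : m ≤ σ - 4 := by
    rcases le_or_gt u (1 / 2) with h | h
    · nlinarith
    · by_contra hc
      push Not at hc
      nlinarith
  exact ⟨by linarith, hm', by linarith⟩

/-- Here x·m/ℓ is the product of the heights of a neighbour and of `p i`. As 8 > 6.8121, a short
edge between them needs a positive horizontal inner product. -/
theorem add_norm_sq_sub_ge {A σ ℓ m x : ℝ} (hA : 4 ≤ A) (hσ' : σ < 8) (hℓ : 4 ≤ ℓ)
    (hm : 0 ≤ m) (hm' : m ≤ σ - 4) (hx : 4 ≤ A - 2 * x + ℓ) : 8 ≤ A + σ - 2 * (x * m / ℓ) := by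
  have hl : 0 < ℓ := by linarith
  suffices h : x * m / ℓ ≤ (A + σ - 8) / 2 by linarith
  rw [div_le_iff₀ hl]
  have h1 : x * m ≤ (A + ℓ - 4) / 2 * m := by
    apply mul_le_mul_of_nonneg_right _ hm; linarith
  have h2 : (A + ℓ - 4) / 2 * m ≤ (A + ℓ - 4) / 2 * (σ - 4) := by
    apply mul_le_mul_of_nonneg_left hm'; linarith
  nlinarith [mul_nonneg (sub_nonneg.2 hA) (show 0 ≤ ℓ - (σ - 4) by linarith)]

/-- A point `c` close to `a` and `b` but behind the axis is incompatible with a convex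
combination of `0`, `a`, `b` on the segment from `q` to `p`. -/
theorem false_of_radon {σ ℓ m u P C x y r c : ℝ} (hu : 0 < u) (hu1 : u < 1) (hc : 0 < c)
    (h1 : 4 ≤ ℓ - 2 * ((1 - u) * ℓ + u * m) + P) (hd : σ - 2 * m + ℓ ≤ 8) (hℓ : 4 ≤ ℓ)
    (hm : 0 ≤ m) (hm' : m ≤ ℓ) (hσ : ℓ ≤ σ) (hC : 4 ≤ C) (hCq : 4 ≤ C - 2 * x + ℓ)
    (hy : y = x * m / ℓ + r) (hr : r ≤ -2)
    (h3 : C - 2 * ((1 - u) * x + u * y) + P ≤ c * 6.8121 + (1 - c) * 8) : False := by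
  have hl : 0 < ℓ := by linarith
  -- The point (1 - u)q + u·p projects to k·q on the axis.
  set k := (1 - u) + u * (m / ℓ) with hk
  have hk0 : 0 ≤ k := add_nonneg (by linarith) (mul_nonneg hu.le (div_nonneg hm hl.le))
  have hk1 : k ≤ 1 := by
    have : m / ℓ ≤ 1 := (div_le_one hl).2 hm'
    nlinarith
  have e : (1 - u) * x + u * y = k * x + u * r := by rw [hy, hk]; ring
  have ek : k * ℓ = (1 - u) * ℓ + u * m := by rw [hk]; field_simp
  rw [e] at h3
  have hcx : 4 - k * ℓ ≤ C - 2 * (k * x) := by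
    nlinarith [mul_nonneg hk0 (sub_nonneg.2 hCq), mul_nonneg (sub_nonneg.2 hk1) (sub_nonneg.2 hC)]
  -- Together `hcx`, `h3` and `h1` give u(m - ℓ) < -4u, hence m < ℓ - 4, and then `hd` gives σ < ℓ.
  nlinarith [mul_nonneg hu.le (show 0 ≤ -2 - r by linarith),
    mul_nonneg hu.le (show 0 ≤ 8 - (σ - 2 * m + ℓ) by linarith),
    mul_nonneg hu.le (sub_nonneg.2 hσ)]

theorem le_convex_combination {r s A B C m : ℝ} (hr : 0 ≤ r) (hs : 0 ≤ s) (h : r + s ≤ 1)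
    (hA : m ≤ A) (hB : m ≤ B) (hC : m ≤ C) : m ≤ r * A + s * B + (1 - r - s) * C := by
  have h1 := mul_le_mul_of_nonneg_left hA hr
  have h2 := mul_le_mul_of_nonneg_left hB hs
  have h3 := mul_le_mul_of_nonneg_left hC (show 0 ≤ 1 - r - s by linarith)
  linarith

/-- The left side averages the squared distances of `v` to `a`, `b` and the origin, so bounds on
these distances control ⟪v, y⟫. -/
theorem convex_combination_dist_sq {a b y : R3} {s t : ℝ} (hy : y = s • a + t • b) (v : R3) :
    s * dist v a ^ 2 + t * dist v b ^ 2 + (1 - s - t) * ‖v‖ ^ 2 =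
      ‖v‖ ^ 2 - 2 * inner ℝ v y + (s * ‖a‖ ^ 2 + t * ‖b‖ ^ 2) := by
  rw [hy, inner_add_right, real_inner_smul_right, real_inner_smul_right, dist_sq_eq, dist_sq_eq]
  ring

namespace IsAxis

variable {p : Fin 4 → R3} {q : R3}

theorem triple_lt_of_cone (hp : IsFrame p) (hq : IsAxis p q) (he : Encircles p q) (i : Fin 4)
    (h : 0 ≤ triple q (p (i + 1)) (p (i + 3))) :
    triple (p (i + 3)) (p i) (p (i + 1)) < triple q (p (i + 3)) (p i) +
      triple q (p i) (p (i + 1)) + triple q (p (i + 1)) (p (i + 3)) := by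
  obtain ⟨e1, e2, e3⟩ := fin_four_add_add i
  have d0 := he.triple_pos i
  have d3 := he.triple_pos (i + 3)
  rw [e3] at d3
  obtain ⟨u, hu, huq⟩ := exists_pos_functional hp he.dual
  obtain ⟨ht, h'⟩ := mem_cone_of_triple (hu _) (hu _) (hu _) huq d0.le h d3
  have := one_lt_of_mem_cone (div_nonneg d0.le ht.le) (div_nonneg h ht.le)
    (div_nonneg d3.le ht.le) h' hq.two_le_norm (hp.norm_lt _) (hp.norm_lt _) (hp.norm_lt _)
    (hq.two_le_dist _) (hq.two_le_dist _) (hq.two_le_dist _)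
  rw [← add_div, ← add_div, lt_div_iff₀ ht] at this
  linarith

/-- A vertex coplanar with its neighbours and the origin lies beyond the line through these. -/
theorem combination_of_coplanar (hp : IsFrame p) (he : Encircles p q) (i : Fin 4)
    (ht : triple (p (i + 3)) (p i) (p (i + 1)) = 0) : ∃ z : ℝ, 0 < z ∧
      z = -triple q (p (i + 1)) (p (i + 3)) ∧ p i = (triple q (p i) (p (i + 1)) / z) • p (i + 3) +
        (triple q (p (i + 3)) (p i) / z) • p (i + 1) ∧
      1 < triple q (p i) (p (i + 1)) / z + triple q (p (i + 3)) (p i) / z := by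
  obtain ⟨e1, e2, e3⟩ := fin_four_add_add i
  have d0 := he.triple_pos i
  have d3 := he.triple_pos (i + 3)
  rw [e3] at d3
  obtain ⟨u, hu⟩ := hp.exists_hemisphere
  obtain ⟨z, hz⟩ : ∃ z, z = -triple q (p (i + 1)) (p (i + 3)) := ⟨_, rfl⟩
  have hc := triple_cramer (p (i + 3)) (p i) (p (i + 1)) q
  rw [ht, zero_smul, show triple q (p (i + 1)) (p (i + 3)) = -z by linarith, neg_smul] at hc
  have hz' : z • p i = triple q (p i) (p (i + 1)) • p (i + 3) +
      triple q (p (i + 3)) (p i) • p (i + 1) := by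
    rw [← sub_eq_zero, ← neg_eq_zero, hc]; abel
  have hz0 : 0 < z := by
    have h := congrArg (inner ℝ u) hz'
    simp only [inner_add_right, real_inner_smul_right] at h
    have k1 := mul_pos d0 (hu (i + 3))
    have k2 := mul_pos d3 (hu (i + 1))
    exact pos_of_mul_pos_left (by linarith) (hu i).le
  have hc' : p i = (triple q (p i) (p (i + 1)) / z) • p (i + 3) +
      (triple q (p (i + 3)) (p i) / z) • p (i + 1) := by
    rw [div_eq_inv_mul, div_eq_inv_mul, mul_smul, mul_smul, ← smul_add,
      ← hz', smul_smul, inv_mul_cancel₀ hz0.ne', one_smul]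
  refine ⟨z, hz0, hz, hc', ?_⟩
  have := one_lt_of_mem_cone (c := p (i + 1)) (div_nonneg d0.le hz0.le) (div_nonneg d3.le hz0.le)
    le_rfl (hc'.trans (by rw [zero_smul, add_zero]))
    (hp.two_le_norm _) (hp.norm_lt _) (hp.norm_lt _) (hp.norm_lt _)
    (hp.two_le_dist _ _ (by fin_cases i <;> decide)) (hp.two_le_dist _ _ (by fin_cases i <;> decide))
    (hp.two_le_dist _ _ (by fin_cases i <;> decide))
  rwa [add_zero] at this

theorem triple_lt_of_coplanar (hp : IsFrame p) (he : Encircles p q) (i : Fin 4)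
    (ht : triple (p (i + 3)) (p i) (p (i + 1)) = 0) :
    0 < triple q (p (i + 3)) (p i) + triple q (p i) (p (i + 1)) +
      triple q (p (i + 1)) (p (i + 3)) := by
  obtain ⟨z, hz0, hz, -, h⟩ := combination_of_coplanar hp he i ht
  rw [← add_div, lt_div_iff₀ hz0] at h
  linarith

/-- Both edges at `p i` turn by less than π/2 and the others by less than 3π/4, so the opposite
vertex is seen within π/4 of the direction opposite to `p i`. The radii are at least √2 and 2. -/
theorem re_opposite_le {w : R3 →ₗ[ℝ] ℂ} (hp : IsFrame p) (hq : IsAxis p q)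
    (hw : IsCylindrical q w) (he : Encircles p q) {i : Fin 4}
    (h0 : 0 < (conj (w (p i)) * w (p (i + 1))).re) (h3 : 0 < (conj (w (p (i + 3))) * w (p i)).re)
    (hr : 4 ≤ ‖w (p i)‖ ^ 2) : (conj (w (p (i + 2))) * w (p i)).re ≤ -2 := by
  obtain ⟨e1, e2, e3⟩ := fin_four_add_add i
  have hrad := two_le_radius_sq hp hq hw he
  obtain ⟨ha, hs⟩ := arg_of_encircles hp hq hw he
  rw [sum_fin_four _ i] at hs
  have a1 := ha (i + 1)
  have a2 := ha (i + 2)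
  have a3 := ha (i + 3)
  rw [e1] at a1
  rw [e2] at a2
  rw [e3] at a3
  rw [e1, e2, e3] at hs
  have b0 := Complex.abs_arg_lt_pi_div_two_iff.2 (Or.inl h0)
  have b3 := Complex.abs_arg_lt_pi_div_two_iff.2 (Or.inl h3)
  have b0' := (abs_lt.1 b0).2
  have b3' := (abs_lt.1 b3).2
  rw [re_conj_mul_eq_cos (ne_zero_of_radius (hrad (i + 3)))]
  set θ := Complex.arg (conj (w (p (i + 2))) * w (p (i + 3))) +
    Complex.arg (conj (w (p (i + 3))) * w (p i)) with hθ
  have hpi := Real.pi_pos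
  have hcos : Real.cos θ ≤ -(√2 / 2) := by
    rw [← Real.cos_pi_div_four, ← neg_neg (Real.cos θ), ← Real.cos_sub_pi, neg_le_neg_iff,
      ← Real.cos_abs (θ - pi)]
    apply Real.cos_le_cos_of_nonneg_of_le_pi (abs_nonneg _) (by linarith)
    rw [abs_le]
    constructor <;> linarith
  have hs2 : √2 ^ 2 = 2 := Real.sq_sqrt (by norm_num)
  have hs0 : 0 < √2 := by positivity
  have r1 : √2 ≤ ‖w (p (i + 2))‖ := Real.sqrt_le_iff.2 ⟨norm_nonneg _, hrad _⟩
  have r2 : 2 ≤ ‖w (p i)‖ := by nlinarith [norm_nonneg (w (p i))]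
  have r3 : √2 * 2 ≤ ‖w (p (i + 2))‖ * ‖w (p i)‖ := by gcongr
  nlinarith [mul_le_mul_of_nonneg_left hcos (show 0 ≤ ‖w (p (i + 2))‖ * ‖w (p i)‖ by positivity),
    mul_le_mul_of_nonneg_right r3 hs0.le]

/-- Cramer's rule, sorted by sign and normalised, is the Radon partition: the segment from `q` to `p
i` meets the triangle of the origin and the two neighbours. -/
theorem exists_radon (he : Encircles p q) (i : Fin 4)
    (h : triple q (p (i + 1)) (p (i + 3)) < 0) (ht : 0 < triple (p (i + 3)) (p i) (p (i + 1)))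
    (hcon : triple q (p (i + 3)) (p i) + triple q (p i) (p (i + 1)) +
      triple q (p (i + 1)) (p (i + 3)) ≤ triple (p (i + 3)) (p i) (p (i + 1))) :
    ∃ u r s : ℝ, 0 < u ∧ u < 1 ∧ 0 < r ∧ 0 < s ∧ r + s ≤ 1 ∧
      (1 - u) • q + u • p i = r • p (i + 3) + s • p (i + 1) := by
  obtain ⟨e1, e2, e3⟩ := fin_four_add_add i
  have d0 := he.triple_pos i
  have d3 := he.triple_pos (i + 3)
  rw [e3] at d3
  set t := triple (p (i + 3)) (p i) (p (i + 1)) with htdef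
  set z := -triple q (p (i + 1)) (p (i + 3)) with hz
  set x := triple q (p i) (p (i + 1)) with hx
  set y := triple q (p (i + 3)) (p i) with hy
  have hz0 : 0 < z := by linarith
  have htz : 0 < t + z := by linarith
  have hc := triple_cramer (p (i + 3)) (p i) (p (i + 1)) q
  rw [← htdef, ← hx, ← hy, show triple q (p (i + 1)) (p (i + 3)) = -z by linarith, neg_smul] at hc
  set u := z / (t + z) with hu
  have hu1 : 1 - u = t / (t + z) := by rw [hu]; field_simp; ring
  have hY : (1 - u) • q + u • p i = (x / (t + z)) • p (i + 3) + (y / (t + z)) • p (i + 1) := by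
    have : t • q + z • p i = x • p (i + 3) + y • p (i + 1) := by rw [hc]; abel
    rw [hu1, hu, div_eq_inv_mul, div_eq_inv_mul, div_eq_inv_mul, div_eq_inv_mul, mul_smul,
      mul_smul, mul_smul, mul_smul, ← smul_add, this, smul_add]
  have hu0 : 0 < u := div_pos hz0 htz
  have hu1' : u < 1 := by have : 0 < 1 - u := by rw [hu1]; exact div_pos ht htz
                          linarith
  have hla : 0 < x / (t + z) := div_pos d0 htz
  have hlb : 0 < y / (t + z) := div_pos d3 htz
  have hlab : x / (t + z) + y / (t + z) ≤ 1 := by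
    rw [← add_div, div_le_one htz]; linarith
  exact ⟨u, _, _, hu0, hu1', hla, hlb, hlab, hY⟩

/-- If separation fails, averaging squared distances at the Radon point shows that both neighbours
lie on the side of `p i` as seen along the axis. The opposite vertex is then far behind the axis,
too far for its distances to the neighbours. -/
theorem triple_lt_of_radon (hp : IsFrame p) (hq : IsAxis p q) (he : Encircles p q) (i : Fin 4)
    (hmax : ∀ j, ‖p j‖ ≤ ‖p i‖) (hd : dist (p i) q ≤ √8)
    (h : triple q (p (i + 1)) (p (i + 3)) < 0) (ht : 0 < triple (p (i + 3)) (p i) (p (i + 1))) :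
    triple (p (i + 3)) (p i) (p (i + 1)) < triple q (p (i + 3)) (p i) +
      triple q (p i) (p (i + 1)) + triple q (p (i + 1)) (p (i + 3)) := by
  by_contra hcon
  push Not at hcon
  obtain ⟨e1, e2, e3⟩ := fin_four_add_add i
  obtain ⟨u, la, lb, hu0, hu1', hla, hlb, hlab, hY⟩ := exists_radon he i h ht hcon
  have hv := convex_combination_dist_sq hY
  simp only [inner_add_right, real_inner_smul_right] at hv
  set P := la * ‖p (i + 3)‖ ^ 2 + lb * ‖p (i + 1)‖ ^ 2 with hP
  have sq4 : ∀ {r : ℝ}, 2 ≤ r → 4 ≤ r ^ 2 := fun h => by nlinarith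
  have sqK : ∀ {r : ℝ}, 0 ≤ r → r ≤ 2.61 → r ^ 2 ≤ 6.8121 := fun h h' => by nlinarith
  have h1 := hv q
  have h2 := hv (p i)
  have h3 := hv (p (i + 2))
  rw [real_inner_self_eq_norm_sq, real_inner_comm] at h1
  rw [real_inner_self_eq_norm_sq] at h2
  have hσ := sq4 (hp.two_le_norm i)
  have hσ' := norm_sq_lt (hp.norm_lt i)
  have hℓ := sq4 hq.two_le_norm
  have hmaxsq : ∀ j, ‖p j‖ ^ 2 ≤ ‖p i‖ ^ 2 := fun j =>
    pow_le_pow_left₀ (norm_nonneg _) (hmax j) 2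
  have qa := sq4 (hq.two_le_dist (i + 3))
  have qb := sq4 (hq.two_le_dist (i + 1))
  rw [dist_comm] at qa qb
  have pa := sq4 (hp.two_le_dist i (i + 3) (by fin_cases i <;> decide))
  have pb := sq4 (hp.two_le_dist i (i + 1) (by fin_cases i <;> decide))
  have ca := sqK dist_nonneg (hp.dist_le (i + 2))
  have cb := sqK dist_nonneg (hp.dist_le (i + 1))
  rw [e2] at ca
  rw [e1, dist_comm] at cb
  have hd' : dist (p i) q ^ 2 ≤ 8 := by
    rw [← Real.sq_sqrt (show (0 : ℝ) ≤ 8 by norm_num)]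
    exact pow_le_pow_left₀ dist_nonneg hd 2
  rw [dist_sq_eq] at hd'
  have hPle : P ≤ (la + lb) * ‖p i‖ ^ 2 := by
    rw [hP, add_mul]
    exact add_le_add (mul_le_mul_of_nonneg_left (hmaxsq _) hla.le)
      (mul_le_mul_of_nonneg_left (hmaxsq _) hlb.le)
  have g1 : 4 ≤ ‖q‖ ^ 2 - 2 * ((1 - u) * ‖q‖ ^ 2 + u * inner ℝ (p i) q) + P := by
    rw [← h1]; exact le_convex_combination hla.le hlb.le hlab qa qb hℓ
  have g2 : 4 ≤ ‖p i‖ ^ 2 - 2 * ((1 - u) * inner ℝ (p i) q + u * ‖p i‖ ^ 2) + P := by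
    rw [← h2]; exact le_convex_combination hla.le hlb.le hlab pa pb hσ
  have g3 : ‖p (i + 2)‖ ^ 2 - 2 * ((1 - u) * inner ℝ (p (i + 2)) q +
      u * inner ℝ (p (i + 2)) (p i)) + P ≤ (la + lb) * 6.8121 + (1 - (la + lb)) * 8 := by
    rw [← h3]
    have k1 := mul_le_mul_of_nonneg_left ca hla.le
    have k2 := mul_le_mul_of_nonneg_left cb hlb.le
    have k3 := mul_le_mul_of_nonneg_left (norm_sq_lt (hp.norm_lt (i + 2))).le
      (show 0 ≤ 1 - la - lb by linarith)
    linarith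
  obtain ⟨hm, hm', hℓσ⟩ := radon_bounds hu0 hu1' hlab hPle g1 g2 hd' hσ hσ' hℓ
  obtain ⟨w, hw⟩ := exists_isCylindrical hq.ne_zero
  have hL : 0 < ‖q‖ := norm_pos_iff.2 hq.ne_zero
  have hh : ∀ j, height q (p j) * height q (p i) =
      inner ℝ (p j) q * inner ℝ (p i) q / ‖q‖ ^ 2 := by
    intro j
    rw [height, height, real_inner_comm, real_inner_comm (p i)]; field_simp
  have near : ∀ j, dist (p j) (p i) ≤ 2.61 → 0 < (conj (w (p j)) * w (p i)).re := by
    intro j hj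
    have := add_norm_sq_sub_ge (sq4 (hp.two_le_norm j)) hσ' hℓ hm hm'
      (four_le_dist_sq (hq.two_le_dist j))
    rw [← hh] at this
    have h' := dist_sq_le hj
    rw [hw.1] at h'
    linarith
  have n3 := near (i + 3) (by have := hp.dist_le (i + 3); rwa [e3] at this)
  have n1 := near (i + 1) (by rw [dist_comm]; exact hp.dist_le i)
  have hrp : 4 ≤ ‖w (p i)‖ ^ 2 := by
    have h5 := hw.norm_sq (p i)
    have h6 : height q (p i) ^ 2 ≤ ‖p i‖ ^ 2 - 4 := by
      rw [pow_two, hh, div_le_iff₀ (by positivity)]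
      have k1 := mul_le_mul hm' hm' hm (hm.trans hm')
      have k2 := mul_le_mul_of_nonneg_left (show ‖p i‖ ^ 2 - 4 ≤ ‖q‖ ^ 2 by linarith)
        (hm.trans hm')
      linarith
    linarith
  have hre := re_opposite_le hp hq hw he
    (by rw [show (conj (w (p i)) * w (p (i + 1))).re = (conj (w (p (i + 1))) * w (p i)).re by
          simp; ring]; exact n1) n3 hrp
  exact false_of_radon hu0 hu1' (add_pos hla hlb) g1 hd' hℓ hm (by linarith) hℓσ
    (sq4 (hp.two_le_norm _)) (four_le_dist_sq (hq.two_le_dist (i + 2)))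
    (by rw [hw.1, hh]) hre g3

/-- The plane through a vertex of maximal norm and its two neighbours separates `q` from the
origin, if the four points are positively oriented. -/
theorem triple_lt_sum (hp : IsFrame p) (hq : IsAxis p q) (he : Encircles p q) (i : Fin 4)
    (hmax : ∀ j, ‖p j‖ ≤ ‖p i‖) (hd : dist (p i) q ≤ √8)
    (ht : 0 ≤ triple (p (i + 3)) (p i) (p (i + 1))) :
    triple (p (i + 3)) (p i) (p (i + 1)) < triple q (p (i + 3)) (p i) +
      triple q (p i) (p (i + 1)) + triple q (p (i + 1)) (p (i + 3)) := by
  rcases ht.eq_or_lt with h0 | h0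
  · rw [← h0]; exact triple_lt_of_coplanar hp he i h0.symm
  rcases le_or_gt 0 (triple q (p (i + 1)) (p (i + 3))) with h | h
  · exact triple_lt_of_cone hp hq he i h
  · exact triple_lt_of_radon hp hq he i hmax hd h h0

end IsAxis

/-! ### Reflecting a vertex -/

theorem arg_conj_mul_add {a b c : ℂ} (ha : a ≠ 0) (hb : b ≠ 0) (hc : c ≠ 0)
    (h0 : 0 < Complex.arg (conj a * c)) (h1 : Complex.arg (conj a * c) < pi)
    (h : 0 < Complex.arg (conj a * b) ∧ Complex.arg (conj a * b) < pi ∨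
      0 < Complex.arg (conj b * c) ∧ Complex.arg (conj b * c) < pi) :
    Complex.arg (conj a * b) + Complex.arg (conj b * c) = Complex.arg (conj a * c) := by
  have ha' : conj a ≠ 0 := (map_ne_zero _).2 ha
  have hb' : conj b ≠ 0 := (map_ne_zero _).2 hb
  have e : ((Complex.arg (conj a * b) + Complex.arg (conj b * c) : ℝ) : Real.Angle) =
      (Complex.arg (conj a * c) : ℝ) := by
    rw [Real.Angle.coe_add, ← Complex.arg_mul_coe_angle (mul_ne_zero ha' hb) (mul_ne_zero hb' hc),
      conj_mul_mul_conj_mul, Complex.arg_real_mul _ (by positivity)]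
  obtain ⟨k, hk⟩ := Real.Angle.angle_eq_iff_two_pi_dvd_sub.1 e
  have hpi := Real.pi_pos
  have u1 := Complex.arg_le_pi (conj a * b)
  have u2 := Complex.arg_le_pi (conj b * c)
  have v1 := Complex.neg_pi_lt_arg (conj a * b)
  have v2 := Complex.neg_pi_lt_arg (conj b * c)
  have k0 : k = 0 := by
    have k1 : (k : ℝ) < 1 := by
      by_contra hcon
      push Not at hcon
      rcases h with h | h <;> nlinarith
    have k2 : (-1 : ℝ) < k := by
      by_contra hcon
      push Not at hcon
      rcases h with h | h <;> nlinarith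
    have k1' : k < 1 := by exact_mod_cast k1
    have k2' : -1 < k := by exact_mod_cast k2
    omega
  rw [k0] at hk
  simp at hk
  linarith

/-- The reflection in the plane orthogonal to `n`. -/
noncomputable def mirror (n x : R3) : R3 := x - (2 * inner ℝ n x / ‖n‖ ^ 2) • n

theorem inner_mirror (n x v : R3) :
    inner ℝ (mirror n x) v = inner ℝ x v - 2 * inner ℝ n x / ‖n‖ ^ 2 * inner ℝ n v := by
  rw [mirror, inner_sub_left, real_inner_smul_left]

theorem inner_normal_mirror {n : R3} (hn : n ≠ 0) (x : R3) :
    inner ℝ n (mirror n x) = -inner ℝ n x := by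
  have : ‖n‖ ≠ 0 := norm_ne_zero_iff.2 hn
  rw [real_inner_comm, inner_mirror, real_inner_self_eq_norm_sq, real_inner_comm x n]
  field_simp
  ring

theorem norm_mirror (n x : R3) : ‖mirror n x‖ = ‖x‖ := by
  rcases eq_or_ne n 0 with rfl | hn
  · simp [mirror]
  have h : ‖mirror n x‖ ^ 2 = ‖x‖ ^ 2 := by
    rw [← real_inner_self_eq_norm_sq, inner_mirror, inner_normal_mirror hn, real_inner_comm,
      inner_mirror, real_inner_self_eq_norm_sq]
    ring
  exact (sq_eq_sq₀ (norm_nonneg _) (norm_nonneg _)).1 h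

theorem dist_mirror_sq (n x v : R3) : dist (mirror n x) v ^ 2 =
    dist x v ^ 2 + 4 * (inner ℝ n x * inner ℝ n v) / ‖n‖ ^ 2 := by
  rw [dist_sq_eq, dist_sq_eq, norm_mirror, inner_mirror]
  ring

theorem dist_mirror_of_inner_eq_zero {n v : R3} (x : R3) (h : inner ℝ n v = 0) :
    dist (mirror n x) v = dist x v := by
  have := dist_mirror_sq n x v
  rw [h, mul_zero, mul_zero, zero_div, add_zero] at this
  exact (sq_eq_sq₀ dist_nonneg dist_nonneg).1 this

theorem dist_le_dist_mirror {n x v : R3} (hx : 0 ≤ inner ℝ n x) (hv : 0 ≤ inner ℝ n v) :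
    dist x v ≤ dist (mirror n x) v := by
  refine (sq_le_sq₀ dist_nonneg dist_nonneg).1 ?_
  rw [dist_mirror_sq]
  have : 0 ≤ 4 * (inner ℝ n x * inner ℝ n v) / ‖n‖ ^ 2 := by positivity
  linarith

namespace IsAxis

variable {p p' : Fin 4 → R3} {q : R3}

/-- Otherwise a functional positive on the vertices and nonnegative on `q` contradicts the signs in
Cramer's rule. So a reflex corner lies on the same side as `q` of the plane through the origin and
its neighbours. -/
theorem triple_pos_of_triple_neg (hp : IsFrame p) (he : Encircles p q) {i : Fin 4}
    (ht : triple (p (i + 3)) (p i) (p (i + 1)) < 0) : 0 < triple q (p (i + 3)) (p (i + 1)) := by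
  obtain ⟨e1, e2, e3⟩ := fin_four_add_add i
  obtain ⟨u, hu, huq⟩ := exists_pos_functional hp he.dual
  have hc := congrArg (inner ℝ u) (triple_cramer (p (i + 3)) (p i) (p (i + 1)) q)
  simp only [inner_add_right, real_inner_smul_right] at hc
  rw [triple_swap q (p (i + 3))] at hc
  have h3 := he.triple_pos (i + 3)
  rw [e3] at h3
  have k1 := mul_pos (he.triple_pos i) (hu (i + 3))
  have k2 := mul_pos h3 (hu (i + 1))
  have k3 := mul_nonpos_of_nonpos_of_nonneg ht.le huq
  by_contra hcon
  push Not at hcon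
  have k4 := mul_nonneg (neg_nonneg.2 hcon) (hu i).le
  linarith

theorem cone_of_triple_pos (hp : IsFrame p) (he : Encircles p q) {i : Fin 4}
    (ht : 0 < triple q (p (i + 3)) (p (i + 1))) :
    0 < triple (p (i + 3)) (p (i + 1)) (p (i + 2)) ∧ ∃ α β γ : ℝ, 0 ≤ α ∧ 0 ≤ β ∧ 0 < γ ∧
      q = α • p (i + 3) + β • p (i + 1) + γ • p (i + 2) := by
  obtain ⟨e1, e2, e3⟩ := fin_four_add_add i
  obtain ⟨u, hu, huq⟩ := exists_pos_functional hp he.dual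
  have h1 := he.triple_pos (i + 1)
  have h2 := he.triple_pos (i + 2)
  rw [e1] at h1
  rw [e2] at h2
  obtain ⟨h, hcone⟩ := mem_cone_of_triple (hu (i + 3)) (hu (i + 1)) (hu (i + 2)) huq h1.le h2.le ht
  exact ⟨h, _, _, _, div_nonneg h1.le h.le, div_nonneg h2.le h.le, div_pos ht h, hcone⟩

/-- If `q` lies in the cone of three vertices, then the fourth vertex can be replaced by any point
on the other side of the plane through the origin and its neighbours. -/
theorem encircles_of_replace (hp : IsFrame p) (he : Encircles p q)
    (hp' : IsFrame p') (hq' : IsAxis p' q) {i : Fin 4} (hi : ∀ j, j ≠ i → p' j = p j)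
    (ht : 0 < triple q (p (i + 3)) (p (i + 1)))
    (ht' : 0 ≤ triple (p' (i + 3)) (p' i) (p' (i + 1))) : Encircles p' q := by
  obtain ⟨e1, e2, e3⟩ := fin_four_add_add i
  obtain ⟨-, α, β, γ, hα, hβ, hγ, h⟩ := cone_of_triple_pos hp he ht
  have i1 := hi (i + 1) (by fin_cases i <;> decide)
  have i2 := hi (i + 2) (by fin_cases i <;> decide)
  have i3 := hi (i + 3) (by fin_cases i <;> decide)
  have h1 := he.triple_pos (i + 1)
  have h2 := he.triple_pos (i + 2)
  rw [e1, ← i1, ← i2] at h1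
  rw [e2, ← i2, ← i3] at h2
  rw [← i1, ← i3] at ht
  rw [← i1, ← i2, ← i3] at h
  have hd : InDualCone p' q := by
    intro v hv
    rw [h, inner_add_right, inner_add_right, real_inner_smul_right, real_inner_smul_right,
      real_inner_smul_right]
    exact add_nonneg (add_nonneg (mul_nonneg hα (hv _).le) (mul_nonneg hβ (hv _).le))
      (mul_nonneg hγ.le (hv _).le)
  obtain ⟨w, hw⟩ := exists_isCylindrical hq'.ne_zero
  obtain ⟨u, hu, huq⟩ := exists_pos_functional hp' hd
  -- At least one new edge turns forwards; this suffices for the two new angles to add up without a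
  -- jump of 2π.
  have hor : 0 < triple q (p' (i + 3)) (p' i) ∨ 0 < triple q (p' i) (p' (i + 1)) := by
    have hc := congrArg (inner ℝ u) (triple_cramer (p' (i + 3)) (p' i) (p' (i + 1)) q)
    simp only [inner_add_right, real_inner_smul_right] at hc
    rw [triple_swap q (p' (i + 3))] at hc
    by_contra! hcon
    have k1 := mul_nonpos_of_nonpos_of_nonneg hcon.1 (hu (i + 1)).le
    have k2 := mul_nonpos_of_nonpos_of_nonneg hcon.2 (hu (i + 3)).le
    have k3 := mul_nonneg ht' huq
    have k4 := mul_pos ht (hu i)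
    linarith
  have hne : ∀ {a b : R3}, 0 < triple q a b → w a ≠ 0 ∧ w b ≠ 0 := by
    intro a b hab
    have := (hw.triple_pos_iff hq'.ne_zero).1 hab
    constructor <;> (intro h0; rw [h0] at this; simp at this)
  have n3 := (hne ht).1
  have n1 := (hne ht).2
  have n2 := (hne h1).2
  have n0 : w (p' i) ≠ 0 := hor.elim (fun h => (hne h).2) (fun h => (hne h).1)
  have a1 := arg_pos_of_triple hq' hw h1
  have a2 := arg_pos_of_triple hq' hw h2
  have a3 := arg_pos_of_triple hq' hw ht
  have hadd := arg_conj_mul_add n3 n0 n1 a3.1 a3.2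
    (hor.imp (arg_pos_of_triple hq' hw) (arg_pos_of_triple hq' hw))
  have h0 := fin_four_cases (P := fun j => w (p' j) ≠ 0) i n0 n1 n2 n3
  refine encircles_of_sum_arg hp' hq' hd hw h0 (fin_four_cases i ?_ ?_ ?_ ?_) ?_
  · rcases hor with hor | hor
    · linarith [(arg_pos_of_triple hq' hw hor).1]
    · exact (arg_pos_of_triple hq' hw hor).2
  · rw [e1]; exact a1.2
  · rw [e2]; exact a2.2
  · rw [e3]
    rcases hor with hor | hor
    · exact (arg_pos_of_triple hq' hw hor).2
    · linarith [(arg_pos_of_triple hq' hw hor).1]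
  · obtain ⟨n, hn⟩ := exists_int_sum_arg h0
    have hs := sum_fin_four (fun j => Complex.arg (conj (w (p' j)) * w (p' (j + 1)))) i
    rw [e1, e2, e3, hn] at hs
    rw [hn]
    have hpi := Real.pi_pos
    have b1 : (n : ℝ) < 2 := by
      by_contra hcon
      push Not at hcon
      nlinarith
    have b2 : (0 : ℝ) < n := by
      by_contra hcon
      push Not at hcon
      nlinarith
    have c1 : n < 2 := by exact_mod_cast b1
    have c2 : 0 < n := by exact_mod_cast b2
    obtain rfl : n = 1 := by omega
    simp

end IsAxis

/-! ### Linking versus encircling -/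

theorem signedDihedralAngle_eq {q : R3} {w : R3 →ₗ[ℝ] ℂ} (hw : IsCylindrical q w) (hq : q ≠ 0)
    (a b : R3) : signedDihedralAngle q a b = Complex.arg (conj (w a) * w b) := by
  have hn : 0 < ‖q‖ := norm_pos_iff.2 hq
  rw [signedDihedralAngle, ← Complex.arg_real_mul (conj (w a) * w b) (show 0 < ‖q‖ ^ 2 by positivity)]
  congr 1
  apply Complex.ext
  · rw [Complex.re_ofReal_mul, hw.1, height, height]
    field_simp
    ring
  · rw [Complex.im_ofReal_mul, dotProduct_crossProduct, hw.2]
    ring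

theorem IsCylindrical.neg {q : R3} {w : R3 →ₗ[ℝ] ℂ} (hw : IsCylindrical q w) :
    IsCylindrical (-q) (Complex.conjAe.toLinearMap ∘ₗ w) := by
  constructor
  · intro a b
    rw [hw.1]
    simp [height]
    ring
  · intro a b
    have h := hw.2 a b
    have : triple (-q) a b = -triple q a b := by simp [triple]; ring
    rw [this, h]
    simp
    ring

theorem InDualCone.of_mem_convexHull {p : Fin 4 → R3} {q : R3} {t : ℝ} (ht : 0 < t)
    (h : t • q ∈ convexHull ℝ (Set.range p)) : InDualCone p q := by
  intro v hv
  have hc : Convex ℝ {x : R3 | 0 ≤ inner ℝ v x} := by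
    intro x hx y hy a b ha hb _
    simp only [Set.mem_ofPred_eq, inner_add_right, real_inner_smul_right] at *
    positivity
  have hs : Set.range p ⊆ {x : R3 | 0 ≤ inner ℝ v x} := by
    rintro _ ⟨i, rfl⟩
    exact (hv i).le
  have := convexHull_min hs hc h
  simp only [Set.mem_ofPred_eq, real_inner_smul_right] at this
  exact nonneg_of_mul_nonneg_right this ht

theorem InDualCone.neg {p : Fin 4 → R3} {q : R3} (h : InDualCone p q) : InDualCone (-p) (-q) := by
  intro v hv
  rw [inner_neg_right, ← inner_neg_left]
  refine h _ fun i => ?_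
  have := hv i
  rwa [Pi.neg_apply, inner_neg_right, ← inner_neg_left] at this

theorem IsFrame.neg {p : Fin 4 → R3} (h : IsFrame p) : IsFrame (-p) where
  two_le_norm i := by simpa using h.two_le_norm i
  norm_lt i := by simpa using h.norm_lt i
  two_le_dist i j hij := by simpa using h.two_le_dist i j hij
  dist_le i := by simpa using h.dist_le i

theorem IsAxis.neg {p : Fin 4 → R3} {q : R3} (h : IsAxis p q) : IsAxis (-p) (-q) where
  two_le_norm := by simpa using h.two_le_norm
  norm_le := by simpa using h.norm_le
  two_le_dist i := by simpa using h.two_le_dist i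

/-- If the angle were π, the segment would pass through 0, that is, the edge would meet the axis. -/
theorem ne_zero_and_arg_ne_pi {a b : ℂ} (h : ∀ s t : ℝ, 0 ≤ s → 0 ≤ t → s + t = 1 →
    (s : ℂ) * a + t * b ≠ 0) : a ≠ 0 ∧ Complex.arg (conj a * b) ≠ pi := by
  have ha : a ≠ 0 := by simpa using h 1 0 zero_le_one le_rfl (add_zero _)
  refine ⟨ha, fun hpi => ?_⟩
  obtain ⟨hre, him⟩ := Complex.arg_eq_pi_iff.1 hpi
  have hn : 0 < ‖a‖ ^ 2 := by positivity
  set r := (conj a * b).re with hr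
  have hab : conj a * b = (r : ℂ) := Complex.ext (by simp [hr]) (by rw [him]; simp)
  have hs : 0 < ‖a‖ ^ 2 - r := by linarith
  refine h (-r / (‖a‖ ^ 2 - r)) (‖a‖ ^ 2 / (‖a‖ ^ 2 - r)) (div_nonneg (by linarith) hs.le)
    (by positivity) (by field_simp; ring) ?_
  have key : (-r : ℂ) * a + (‖a‖ ^ 2 : ℝ) * b = 0 := by
    rw [← hab, ← Complex.normSq_eq_norm_sq, ← Complex.mul_conj]; ring
  have : (((-r / (‖a‖ ^ 2 - r) : ℝ)) : ℂ) * a + ((‖a‖ ^ 2 / (‖a‖ ^ 2 - r) : ℝ) : ℂ) * b =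
      ((-r : ℂ) * a + (‖a‖ ^ 2 : ℝ) * b) / ((‖a‖ ^ 2 - r : ℝ) : ℂ) := by
    push_cast; ring
  rw [this, key, zero_div]

/-- Four angles strictly between -π and π add up to 2πn with |n| < 2, and n ≠ 0 by linking. Point
reflection in the origin turns n = -1 into n = 1. -/
theorem HalfLineLinks.encircles {p : Fin 4 → R3} {q : R3} (h : HalfLineLinks q p) (hp : IsFrame p)
    (hq : IsAxis p q) : Encircles p q ∨ Encircles (-p) (-q) := by
  obtain ⟨⟨hq0, hseg, hlink⟩, t, ht, hmem⟩ := h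
  have hd := InDualCone.of_mem_convexHull ht hmem
  obtain ⟨w, hw⟩ := exists_isCylindrical hq0
  have hker : ∀ x, w x = 0 → x ∈ Submodule.span ℝ {q} := by
    intro x hx
    have hn : 0 < ‖q‖ := norm_pos_iff.2 hq0
    refine Submodule.mem_span_singleton.2 ⟨height q x / ‖q‖, ?_⟩
    have h1 := hw.norm_sq ((height q x / ‖q‖) • q - x)
    have h2 : height q ((height q x / ‖q‖) • q - x) = 0 := by
      rw [height, inner_sub_right, real_inner_smul_right, real_inner_self_eq_norm_sq, height]
      field_simp
      ring
    rw [map_sub, map_smul, hw.map_axis hq0, hx, h2] at h1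
    rw [← sub_eq_zero]
    simpa using h1
  have hne := fun i => ne_zero_and_arg_ne_pi (a := w (p i)) (b := w (p (i + 1)))
    fun s r hs hr hsr h0 => hseg i (s • p i + r • p (i + 1)) ⟨s, r, hs, hr, hsr, rfl⟩
      (hker _ (by rw [map_add, map_smul, map_smul]; simpa using h0))
  have h0 := fun i => (hne i).1
  have hlt : ∀ i, Complex.arg (conj (w (p i)) * w (p (i + 1))) < pi := fun i =>
    lt_of_le_of_ne (Complex.arg_le_pi _) (hne i).2
  have hgt : ∀ i, -pi < Complex.arg (conj (w (p i)) * w (p (i + 1))) := fun i =>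
    Complex.neg_pi_lt_arg _
  obtain ⟨n, hn⟩ := exists_int_sum_arg h0
  have hn0 : n ≠ 0 := by
    rintro rfl
    apply hlink
    simp only [linkingNumber, signedDihedralAngle_eq hw hq0]
    rw [hn]
    simp
  have hs := hn
  rw [Fin.sum_univ_four] at hs
  have hpi := Real.pi_pos
  have b1 : (n : ℝ) < 2 := by
    by_contra hcon
    push Not at hcon
    nlinarith [hlt 0, hlt 1, hlt 2, hlt 3]
  have b2 : (-2 : ℝ) < n := by
    by_contra hcon
    push Not at hcon
    nlinarith [hgt 0, hgt 1, hgt 2, hgt 3]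
  have c1 : n < 2 := by exact_mod_cast b1
  have c2 : -2 < n := by exact_mod_cast b2
  obtain rfl | rfl : n = 1 ∨ n = -1 := by omega
  · exact Or.inl (hq.encircles_of_sum_arg hp hd hw h0 hlt (by rw [hn]; simp))
  · right
    have e : ∀ i, conj ((Complex.conjAe.toLinearMap ∘ₗ w) ((-p) i)) *
        (Complex.conjAe.toLinearMap ∘ₗ w) ((-p) (i + 1)) =
        conj (conj (w (p i)) * w (p (i + 1))) := by
      intro i; simp
    have e' : ∀ i, Complex.arg (conj ((Complex.conjAe.toLinearMap ∘ₗ w) ((-p) i)) *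
        (Complex.conjAe.toLinearMap ∘ₗ w) ((-p) (i + 1))) =
        -Complex.arg (conj (w (p i)) * w (p (i + 1))) := by
      intro i
      rw [e, Complex.arg_conj, if_neg (hne i).2]
    refine hq.neg.encircles_of_sum_arg hp.neg hd.neg hw.neg (fun i => by simpa using h0 i) ?_ ?_
    · intro i
      rw [e']
      linarith [hgt i]
    · simp only [e', Finset.sum_neg_distrib]
      rw [hn]
      push_cast
      ring

theorem exists_smul_mem_convexHull {s : Set R3} {x y z q : R3} {α β γ : ℝ} (hx : x ∈ s)
    (hy : y ∈ s) (hz : z ∈ s) (hα : 0 ≤ α) (hβ : 0 ≤ β) (hγ : 0 < γ)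
    (h : q = α • x + β • y + γ • z) : ∃ t : ℝ, 0 < t ∧ t • q ∈ convexHull ℝ s := by
  have hs : 0 < α + β + γ := by linarith
  refine ⟨(α + β + γ)⁻¹, by positivity, ?_⟩
  have hz' : ∀ i, (![x, y, z] : Fin 3 → R3) i ∈ convexHull ℝ s := by
    intro i
    apply subset_convexHull
    fin_cases i <;> assumption
  have := (convex_convexHull ℝ s).sum_mem (t := Finset.univ) (z := ![x, y, z])
    (w := ![(α + β + γ)⁻¹ * α, (α + β + γ)⁻¹ * β, (α + β + γ)⁻¹ * γ])
    (fun i _ => by fin_cases i <;> simp <;> positivity)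
    (by simp [Fin.sum_univ_three]; field_simp) (fun i _ => hz' i)
  convert this using 1
  rw [Fin.sum_univ_three, h]
  simp [smul_smul]

namespace IsAxis

variable {p : Fin 4 → R3} {q : R3}

theorem cone_of_triple_nonpos (hp : IsFrame p) (he : Encircles p q) {i : Fin 4}
    (ht : triple q (p (i + 3)) (p (i + 1)) ≤ 0) :
    0 < triple (p (i + 3)) (p i) (p (i + 1)) ∧ ∃ α β γ : ℝ, 0 ≤ α ∧ 0 ≤ β ∧ 0 < γ ∧
      q = α • p (i + 3) + β • p i + γ • p (i + 1) := by
  obtain ⟨e1, e2, e3⟩ := fin_four_add_add i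
  obtain ⟨u, hu, huq⟩ := exists_pos_functional hp he.dual
  have h0 := he.triple_pos i
  have h3 := he.triple_pos (i + 3)
  rw [e3] at h3
  rw [triple_swap, neg_nonpos] at ht
  obtain ⟨h, h'⟩ := mem_cone_of_triple (hu (i + 3)) (hu i) (hu (i + 1)) huq h0.le ht h3
  exact ⟨h, _, _, _, div_nonneg h0.le h.le, div_nonneg ht h.le, div_pos h3 h, h'⟩

theorem halfLineLinks (hp : IsFrame p) (hq : IsAxis p q) (he : Encircles p q) :
    HalfLineLinks q p := by
  obtain ⟨w, hw⟩ := exists_isCylindrical hq.ne_zero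
  refine ⟨⟨hq.ne_zero, ?_, ?_⟩, ?_⟩
  · rintro i x ⟨s, t, hs, ht, hst, rfl⟩ hx
    obtain ⟨c, hc⟩ := Submodule.mem_span_singleton.1 hx
    have h0 := congrArg w hc
    rw [map_smul, hw.map_axis hq.ne_zero, smul_zero, map_add, map_smul, map_smul] at h0
    have him := (hw.triple_pos_iff hq.ne_zero).1 (he.triple_pos i)
    have h1 := congrArg (fun z => (conj (w (p i)) * z).im) h0
    have h2 := congrArg (fun z => (conj (w (p (i + 1))) * z).im) h0
    simp at h1 h2 him
    have h1' : t * ((w (p i)).re * (w (p (i + 1))).im + -((w (p i)).im * (w (p (i + 1))).re)) = 0 := by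
      linarith
    have h2' : s * ((w (p i)).re * (w (p (i + 1))).im + -((w (p i)).im * (w (p (i + 1))).re)) = 0 := by
      linarith
    have t0 := (mul_eq_zero.1 h1').resolve_right (by linarith)
    have s0 := (mul_eq_zero.1 h2').resolve_right (by linarith)
    linarith
  · have := (arg_of_encircles hp hq hw he).2
    simp only [linkingNumber, signedDihedralAngle_eq hw hq.ne_zero]
    rw [this, div_self (by positivity)]
    exact one_ne_zero
  · rcases le_or_gt (triple q (p (0 + 3)) (p (0 + 1))) 0 with h | h
    · obtain ⟨-, α, β, γ, hα, hβ, hγ, h'⟩ := cone_of_triple_nonpos hp he h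
      exact exists_smul_mem_convexHull ⟨_, rfl⟩ ⟨_, rfl⟩ ⟨_, rfl⟩ hα hβ hγ h'
    · obtain ⟨-, α, β, γ, hα, hβ, hγ, h'⟩ := cone_of_triple_pos hp he h
      exact exists_smul_mem_convexHull ⟨_, rfl⟩ ⟨_, rfl⟩ ⟨_, rfl⟩ hα hβ hγ h'

theorem triple_pos_or (hp : IsFrame p) (he : Encircles p q) (i : Fin 4) :
    0 < triple (p (i + 3)) (p i) (p (i + 1)) ∨
      0 < triple (p (i + 1)) (p (i + 2)) (p (i + 3)) := by
  rcases le_or_gt (triple q (p (i + 3)) (p (i + 1))) 0 with h | h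
  · exact Or.inl (cone_of_triple_nonpos hp he h).1
  · right
    rw [← triple_rotate]
    exact (cone_of_triple_pos hp he h).1

theorem not_triple_neg_neg (hp : IsFrame p) (he : Encircles p q) {i : Fin 4}
    (h0 : triple (p (i + 3)) (p i) (p (i + 1)) < 0)
    (h1 : triple (p i) (p (i + 1)) (p (i + 2)) < 0) : False := by
  obtain ⟨e1, e2, e3⟩ := fin_four_add_add i
  have e4 : i + 1 + 3 = i := by fin_cases i <;> rfl
  have e5 : i + 1 + 2 = i + 3 := by fin_cases i <;> rfl
  have t1 := triple_pos_of_triple_neg (i := i + 1) hp he (by rw [e4, e1]; exact h1)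
  have t3 := (cone_of_triple_pos hp he t1).1
  rw [e4, e1] at t1
  rw [e4, e1, e5] at t3
  have d0 := he.triple_pos i
  have d3 := he.triple_pos (i + 3)
  rw [e3] at d3
  -- A Plücker relation: with both corners negative, the left side is negative and the right side
  -- positive.
  have key : triple (p i) (p (i + 1)) (p (i + 2)) * triple q (p (i + 3)) (p i) =
      triple (p i) (p (i + 2)) (p (i + 3)) * triple q (p i) (p (i + 1)) -
        triple (p (i + 3)) (p i) (p (i + 1)) * triple q (p i) (p (i + 2)) := by
    simp only [triple]; ring
  nlinarith [mul_pos t3 d0, mul_pos (neg_pos.2 h0) t1, mul_pos (neg_pos.2 h1) d3]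

/-- Two half-lines cannot be encircled in opposite directions. -/
theorem not_encircles_neg {q' : R3} (hp : IsFrame p) (he : Encircles p q) (he' : Encircles (-p) q') :
    False := by
  -- Encircling in the other direction makes a corner negative in each opposite pair, hence two
  -- adjacent corners.
  have h0 := triple_pos_or hp.neg he' 0
  have h1 := triple_pos_or hp.neg he' 1
  simp only [Pi.neg_apply, triple_neg_neg_neg, Left.neg_pos_iff] at h0 h1
  have k := fun i => not_triple_neg_neg (i := i) hp he
  rcases h0 with h0 | h0 <;> rcases h1 with h1 | h1
  · exact k 0 h0 h1
  · exact k 3 h1 h0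
  · exact k 1 h1 h0
  · exact k 2 h0 h1

end IsAxis

/-! ### Admissible vertex systems: openness and compactness -/

open Filter Topology

/-- The bounds on distances and on the points `q j` under which configurations are studied. -/
structure Bounds {ι : Type*} (l k h : Fin 4 → ℝ) (q : ι → R3) : Prop where
  l_lt : ∀ i, l i < √8
  k_le : ∀ i, k i ≤ 2.61
  two_le_h : ∀ i, 2 ≤ h i
  h_le : ∀ i, h i ≤ √8
  two_le_norm : ∀ j, 2 ≤ ‖q j‖
  norm_le : ∀ j, ‖q j‖ ≤ √8

/-- The constraints on the distances between the vertices `p i`, the origin and the points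
`q j`. -/
structure MetricConfig {ι : Type*} (l k h : Fin 4 → ℝ) (q : ι → R3) (p : Fin 4 → R3) : Prop where
  two_le_norm : ∀ i, 2 ≤ ‖p i‖
  norm_le : ∀ i, ‖p i‖ ≤ l i
  two_le_dist : ∀ i j, i ≠ j → 2 ≤ dist (p i) (p j)
  dist_le : ∀ i, dist (p i) (p (i + 1)) ≤ k i
  le_dist : ∀ i j, h i ≤ dist (p i) (q j)

/-- The constraints on the vertices `p i`, for given points `q j`. -/
structure Admissible {ι : Type*} (l k h : Fin 4 → ℝ) (q : ι → R3) (p : Fin 4 → R3) : Prop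
    extends MetricConfig l k h q p where
  encircles : ∀ j, Encircles p (q j)

section Admissible

variable {ι : Type*} {l k h : Fin 4 → ℝ} {q : ι → R3} {p : Fin 4 → R3}

theorem MetricConfig.isFrame (hc : MetricConfig l k h q p) (hb : Bounds l k h q) : IsFrame p where
  two_le_norm := hc.two_le_norm
  norm_lt i := (hc.norm_le i).trans_lt (hb.l_lt i)
  two_le_dist := hc.two_le_dist
  dist_le i := (hc.dist_le i).trans (hb.k_le i)

theorem MetricConfig.isAxis (hc : MetricConfig l k h q p) (hb : Bounds l k h q) (j : ι) :
    IsAxis p (q j) where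
  two_le_norm := hb.two_le_norm j
  norm_le := hb.norm_le j
  two_le_dist i := (hb.two_le_h i).trans (hc.le_dist i j)

theorem fin_four_ne (i : Fin 4) : i + 1 ≠ i ∧ i + 2 ≠ i ∧ i + 3 ≠ i := by
  fin_cases i <;> decide

theorem MetricConfig.update (hc : MetricConfig l k h q p) {i : Fin 4} {x : R3} (h0 : 2 ≤ ‖x‖)
    (h1 : ‖x‖ ≤ l i) (h2 : 2 ≤ dist x (p (i + 1))) (h3 : dist x (p (i + 1)) ≤ k i)
    (h4 : 2 ≤ dist x (p (i + 2))) (h5 : 2 ≤ dist x (p (i + 3)))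
    (h6 : dist x (p (i + 3)) ≤ k (i + 3)) (h7 : ∀ j, h i ≤ dist x (q j)) :
    MetricConfig l k h q (Function.update p i x) := by
  obtain ⟨e1, e2, e3⟩ := fin_four_add_add i
  obtain ⟨n1, n2, n3⟩ := fin_four_ne i
  have hx : ∀ j, j ≠ i → 2 ≤ dist x (p j) :=
    fin_four_cases i (fun hi => absurd rfl hi) (fun _ => h2) (fun _ => h4) (fun _ => h5)
  constructor
  · intro a
    rcases eq_or_ne a i with rfl | ha
    · simpa using h0
    · rw [Function.update_of_ne ha]; exact hc.two_le_norm a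
  · intro a
    rcases eq_or_ne a i with rfl | ha
    · simpa using h1
    · rw [Function.update_of_ne ha]; exact hc.norm_le a
  · intro a b hab
    rcases eq_or_ne a i with rfl | ha
    · rw [Function.update_self, Function.update_of_ne hab.symm]; exact hx _ hab.symm
    · rw [Function.update_of_ne ha]
      rcases eq_or_ne b i with rfl | hb
      · rw [Function.update_self, dist_comm]; exact hx _ ha
      · rw [Function.update_of_ne hb]; exact hc.two_le_dist a b hab
  · refine fin_four_cases i ?_ ?_ ?_ ?_
    · rw [Function.update_self, Function.update_of_ne n1]; exact h3
    · rw [Function.update_of_ne n1, e1, Function.update_of_ne n2, ← e1]; exact hc.dist_le _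
    · rw [Function.update_of_ne n2, e2, Function.update_of_ne n3, ← e2]; exact hc.dist_le _
    · rw [Function.update_of_ne n3, e3, Function.update_self, dist_comm]; exact h6
  · intro a j
    rcases eq_or_ne a i with rfl | ha
    · simpa using h7 j
    · rw [Function.update_of_ne ha]; exact hc.le_dist a j

/-- One functional suffices for the dual cone condition, because the signs put `q` into the cone of
three vertices. This makes encircling stable under small moves. -/
theorem encircles_of_triple_pos {q u : R3} (hu : ∀ i, 0 < inner ℝ u (p i)) (huq : 0 ≤ inner ℝ u q)
    (h : ∀ i, 0 < triple q (p i) (p (i + 1))) : Encircles p q := by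
  refine ⟨h, fun v hv => ?_⟩
  have key : ∀ {i j m : Fin 4}, 0 ≤ triple q (p j) (p m) → 0 ≤ triple q (p m) (p i) →
      0 < triple q (p i) (p j) → 0 ≤ inner ℝ v q := by
    intro i j m h1 h2 h3
    obtain ⟨hpos, hc⟩ := mem_cone_of_triple (hu i) (hu j) (hu m) huq h1 h2 h3
    have vi := hv i
    have vj := hv j
    have vm := hv m
    rw [hc, inner_add_right, inner_add_right, real_inner_smul_right, real_inner_smul_right,
      real_inner_smul_right]
    positivity
  rcases le_or_gt 0 (triple q (p 2) (p 0)) with h20 | h20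
  · exact key (h 1).le h20 (h 0)
  · exact key (i := 2) (j := 3) (m := 0) (h 3).le (by rw [triple_swap]; linarith) (h 2)

theorem Admissible.eventually_update [Finite ι] [Nonempty ι] (ha : Admissible l k h q p)
    (hb : Bounds l k h q) {i : Fin 4} {F : Filter ℝ} {γ : ℝ → R3} (hγ : Tendsto γ F (𝓝 (p i)))
    (h0 : ∀ᶠ s in F, 2 ≤ ‖γ s‖) (h1 : ∀ᶠ s in F, ‖γ s‖ ≤ l i)
    (h2 : ∀ᶠ s in F, 2 ≤ dist (γ s) (p (i + 1))) (h3 : ∀ᶠ s in F, dist (γ s) (p (i + 1)) ≤ k i)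
    (h5 : ∀ᶠ s in F, 2 ≤ dist (γ s) (p (i + 3)))
    (h6 : ∀ᶠ s in F, dist (γ s) (p (i + 3)) ≤ k (i + 3))
    (h7 : ∀ j, ∀ᶠ s in F, h i ≤ dist (γ s) (q j)) :
    ∀ᶠ s in F, Admissible l k h q (Function.update p i (γ s)) := by
  have hp := ha.isFrame hb
  have hup : Tendsto (fun s => Function.update p i (γ s)) F (𝓝 p) := by
    have := (continuous_const (y := p)).update i (continuous_id (X := R3))
    have h' : Tendsto (fun s => Function.update p i (γ s)) F (𝓝 (Function.update p i (p i))) :=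
      (this.tendsto (p i)).comp hγ
    rwa [Function.update_eq_self] at h'
  obtain ⟨j0⟩ := ‹Nonempty ι›
  have h4 : ∀ᶠ s in F, 2 ≤ dist (γ s) (p (i + 2)) :=
    ((hγ.dist tendsto_const_nhds).eventually_const_lt
      ((ha.isAxis hb j0).two_lt_dist_opposite hp (ha.encircles j0) i)).mono fun s hs => hs.le
  obtain ⟨u, hu⟩ := hp.exists_hemisphere
  have hu' : ∀ᶠ s in F, ∀ m, 0 < inner ℝ u (Function.update p i (γ s) m) := by
    rw [eventually_all]
    intro m
    have hcont : Continuous fun P : Fin 4 → R3 => (inner ℝ u (P m) : ℝ) := by fun_prop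
    exact ((hcont.tendsto p).comp hup).eventually_const_lt (hu m)
  have ht : ∀ᶠ s in F, ∀ j m, 0 < triple (q j) (Function.update p i (γ s) m)
      (Function.update p i (γ s) (m + 1)) := by
    rw [eventually_all]
    intro j
    rw [eventually_all]
    intro m
    have hcont : Continuous fun P : Fin 4 → R3 => triple (q j) (P m) (P (m + 1)) := by
      unfold triple; fun_prop
    exact ((hcont.tendsto p).comp hup).eventually_const_lt ((ha.encircles j).triple_pos m)
  filter_upwards [h0, h1, h2, h3, h4, h5, h6, eventually_all.2 h7, hu', ht] with
    s h0 h1 h2 h3 h4 h5 h6 h7 hu' ht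
  exact ⟨ha.toMetricConfig.update h0 h1 h2 h3 h4 h5 h6 h7, fun j =>
    encircles_of_triple_pos hu' ((ha.encircles j).dual u hu) (ht j)⟩

/-- A description by closed conditions; the last one is the squared radius bound. -/
theorem Admissible.iff_weak (hb : Bounds l k h q) : Admissible l k h q p ↔
    MetricConfig l k h q p ∧ ∀ j, InDualCone p (q j) ∧
      ∀ i, 0 ≤ triple (q j) (p i) (p (i + 1)) ∧ 2 ≤ ‖p i‖ ^ 2 - height (q j) (p i) ^ 2 := by
  constructor
  · intro ha
    refine ⟨ha.toMetricConfig, fun j => ⟨(ha.encircles j).dual, fun i =>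
      ⟨((ha.encircles j).triple_pos i).le, ?_⟩⟩⟩
    have hq := ha.isAxis hb j
    obtain ⟨w, hw⟩ := exists_isCylindrical hq.ne_zero
    have := hq.two_le_radius_sq (ha.isFrame hb) hw (ha.encircles j) i
    rw [hw.norm_sq]
    linarith
  · rintro ⟨hc, hw⟩
    refine ⟨hc, fun j => ?_⟩
    have hq := hc.isAxis hb j
    obtain ⟨w, hcyl⟩ := exists_isCylindrical hq.ne_zero
    refine hq.encircles_of_nonneg (hc.isFrame hb) (hw j).1 hcyl (fun i => ?_)
      fun i => ((hw j).2 i).1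
    have := ((hw j).2 i).2
    rw [hcyl.norm_sq] at this
    linarith

theorem isClosed_metricConfig : IsClosed {p | MetricConfig l k h q p} := by
  have : {p | MetricConfig l k h q p} = {p | ((((∀ i, 2 ≤ ‖p i‖) ∧ ∀ i, ‖p i‖ ≤ l i) ∧
      ∀ i j, i ≠ j → 2 ≤ dist (p i) (p j)) ∧ ∀ i, dist (p i) (p (i + 1)) ≤ k i) ∧
      ∀ i j, h i ≤ dist (p i) (q j)} :=
    Set.ext fun p => ⟨fun h => ⟨⟨⟨⟨h.1, h.2⟩, h.3⟩, h.4⟩, h.5⟩,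
      fun h => ⟨h.1.1.1.1, h.1.1.1.2, h.1.1.2, h.1.2, h.2⟩⟩
  rw [this]
  refine (((IsClosed.and ?_ ?_).and ?_).and ?_).and ?_ <;> simp only [Set.ofPred_forall]
  · exact isClosed_iInter fun i => isClosed_le (by fun_prop) (by fun_prop)
  · exact isClosed_iInter fun i => isClosed_le (by fun_prop) (by fun_prop)
  · exact isClosed_iInter fun i => isClosed_iInter fun j => isClosed_iInter fun _ =>
      isClosed_le (by fun_prop) (by fun_prop)
  · exact isClosed_iInter fun i => isClosed_le (by fun_prop) (by fun_prop)
  · exact isClosed_iInter fun i => isClosed_iInter fun j => isClosed_le (by fun_prop) (by fun_prop)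

theorem isCompact_admissible (hb : Bounds l k h q) : IsCompact {p | Admissible l k h q p} := by
  refine Metric.isCompact_of_isClosed_isBounded ?_ ?_
  · have : {p | Admissible l k h q p} = {p | MetricConfig l k h q p} ∩
        ⋂ j, ({p | InDualCone p (q j)} ∩ ⋂ i, {p | 0 ≤ triple (q j) (p i) (p (i + 1)) ∧
          2 ≤ ‖p i‖ ^ 2 - height (q j) (p i) ^ 2}) := by
      ext p
      simp only [Set.mem_ofPred_eq, Admissible.iff_weak hb, Set.mem_inter_iff, Set.mem_iInter]
    rw [this]
    refine isClosed_metricConfig.inter (isClosed_iInter fun j => IsClosed.inter ?_ ?_)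
    · rw [← isSeqClosed_iff_isClosed]
      intro P p hP hlim v hv
      have : ∀ᶠ n in atTop, ∀ i, 0 < inner ℝ v (P n i) := by
        rw [eventually_all]
        intro i
        have hcont : Continuous fun P : Fin 4 → R3 => (inner ℝ v (P i) : ℝ) := by fun_prop
        exact ((hcont.tendsto p).comp hlim).eventually_const_lt (hv i)
      obtain ⟨n, hn⟩ := this.exists
      exact hP n v hn
    · refine isClosed_iInter fun i => IsClosed.and ?_ ?_
      · exact isClosed_le continuous_const (by unfold triple; fun_prop)
      · exact isClosed_le continuous_const (by unfold height; fun_prop)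
  · refine (Metric.isBounded_closedBall (x := 0) (r := √8)).subset fun p hp => ?_
    rw [mem_closedBall_zero_iff, pi_norm_le_iff_of_nonneg (Real.sqrt_nonneg _)]
    exact fun i => (hp.norm_le i).trans (hb.l_lt i).le

/-- A vertex can be moved to the positive side of its neighbours without changing the lengths. -/
theorem Admissible.exists_mirror [Nonempty ι] (ha : Admissible l k h q p) (hb : Bounds l k h q)
    (i : Fin 4) : ∃ p', Admissible l k h q p' ∧ (∀ j, ‖p' j‖ = ‖p j‖) ∧
      (∀ j, dist (p' j) (p' (j + 1)) = dist (p j) (p (j + 1))) ∧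
      0 ≤ triple (p' (i + 3)) (p' i) (p' (i + 1)) := by
  rcases le_or_gt 0 (triple (p (i + 3)) (p i) (p (i + 1))) with ht | ht
  · exact ⟨p, ha, fun _ => rfl, fun _ => rfl, ht⟩
  obtain ⟨e1, e2, e3⟩ := fin_four_add_add i
  obtain ⟨n1, n2, n3⟩ := fin_four_ne i
  have hp := ha.isFrame hb
  -- The reflex vertex, its opposite vertex and all `q j` lie on the nonnegative side of the mirror,
  -- so the reflection cannot decrease those distances.
  set n := cross (p (i + 3)) (p (i + 1)) with hn
  have hnx : ∀ x, inner ℝ n x = -triple (p (i + 3)) x (p (i + 1)) := fun x => by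
    rw [hn, inner_cross_left, triple_rotate, triple_swap]
  have hpos : 0 < inner ℝ n (p i) := by rw [hnx]; linarith
  have hn0 : n ≠ 0 := by rintro h0; rw [h0, inner_zero_left] at hpos; exact hpos.false
  have hq : ∀ j, 0 < triple (q j) (p (i + 3)) (p (i + 1)) := fun j =>
    IsAxis.triple_pos_of_triple_neg hp (ha.encircles j) ht
  have hqn : ∀ j, 0 ≤ inner ℝ n (q j) := fun j => by rw [hn, inner_cross_left]; exact (hq j).le
  have ha0 : inner ℝ n (p (i + 3)) = 0 := by rw [hn, inner_cross_left, triple_self_left]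
  have hb0 : inner ℝ n (p (i + 1)) = 0 := by rw [hn, inner_cross_left, triple_self_outer]
  obtain ⟨j0⟩ := ‹Nonempty ι›
  have hcn : 0 ≤ inner ℝ n (p (i + 2)) := by
    rw [hn, inner_cross_left, triple_rotate]
    exact (IsAxis.cone_of_triple_pos hp (ha.encircles j0) (hq j0)).1.le
  have hd1 := dist_mirror_of_inner_eq_zero (p i) hb0
  have hd3 := dist_mirror_of_inner_eq_zero (p i) ha0
  have hm : MetricConfig l k h q (Function.update p i (mirror n (p i))) := by
    refine ha.toMetricConfig.update ?_ ?_ ?_ ?_ ?_ ?_ ?_ ?_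
    · rw [norm_mirror]; exact ha.two_le_norm i
    · rw [norm_mirror]; exact ha.norm_le i
    · rw [hd1]; exact ha.two_le_dist _ _ n1.symm
    · rw [hd1]; exact ha.dist_le i
    · exact (ha.two_le_dist _ _ n2.symm).trans (dist_le_dist_mirror hpos.le hcn)
    · rw [hd3]; exact ha.two_le_dist _ _ n3.symm
    · rw [hd3, dist_comm]; have := ha.dist_le (i + 3); rwa [e3] at this
    · exact fun j => (ha.le_dist i j).trans (dist_le_dist_mirror hpos.le (hqn j))
  have ht' : 0 ≤ triple (Function.update p i (mirror n (p i)) (i + 3))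
      (Function.update p i (mirror n (p i)) i) (Function.update p i (mirror n (p i)) (i + 1)) := by
    rw [Function.update_self, Function.update_of_ne n1, Function.update_of_ne n3, ← neg_neg
      (triple _ _ _), ← hnx, inner_normal_mirror hn0, neg_neg]
    exact hpos.le
  refine ⟨_, ⟨hm, fun j => IsAxis.encircles_of_replace hp (ha.encircles j) (hm.isFrame hb)
    (hm.isAxis hb j) (fun m hm => Function.update_of_ne hm _ _) (hq j) ht'⟩, ?_, ?_, ht'⟩
  · intro j
    rcases eq_or_ne j i with rfl | hj
    · rw [Function.update_self, norm_mirror]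
    · rw [Function.update_of_ne hj]
  · refine fin_four_cases i ?_ ?_ ?_ ?_
    · rw [Function.update_self, Function.update_of_ne n1, hd1]
    · rw [Function.update_of_ne n1, e1, Function.update_of_ne n2]
    · rw [Function.update_of_ne n2, e2, Function.update_of_ne n3]
    · rw [Function.update_of_ne n3, e3, Function.update_self, dist_comm, hd3, dist_comm]

end Admissible

/-! ### Rotations about a line -/

theorem norm_cross_sq (a b : R3) : ‖cross a b‖ ^ 2 = ‖a‖ ^ 2 * ‖b‖ ^ 2 - inner ℝ a b ^ 2 := by
  simp only [← real_inner_self_eq_norm_sq, inner_eq_coords, cross]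
  simp
  ring

/-- The rotation of `f + e` about the line through `f` in direction `d`, parametrized by the
tangent of half the angle. -/
noncomputable def rotateAbout (f d e : R3) (s : ℝ) : R3 :=
  f + ((1 - s ^ 2) / (1 + s ^ 2)) • e + (2 * s / (1 + s ^ 2)) • (‖d‖⁻¹ • cross d e)

/-- The triple product decides the change for small s > 0; if it vanishes, the sign of the inner
product does. -/
theorem dist_rotateAbout_sq {d e : R3} (hd : d ≠ 0) (h : inner ℝ d e = 0) (f v : R3) (s : ℝ) :
    dist (rotateAbout f d e s) v ^ 2 = dist (f + e) v ^ 2 +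
      4 * s / (1 + s ^ 2) * (‖d‖⁻¹ * triple (f - v) d e - s * inner ℝ e (f - v)) := by
  have hn : ‖d‖ ≠ 0 := norm_ne_zero_iff.2 hd
  have hs : 1 + s ^ 2 ≠ 0 := by positivity
  have h1 : inner ℝ e (‖d‖⁻¹ • cross d e) = 0 := by
    rw [real_inner_smul_right, inner_cross_right, triple_self_outer, mul_zero]
  have h2 : ‖‖d‖⁻¹ • cross d e‖ ^ 2 = ‖e‖ ^ 2 := by
    rw [norm_smul, mul_pow, norm_cross_sq, h, norm_inv, norm_norm]
    field_simp
    ring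
  have h3 : inner ℝ (f - v) (‖d‖⁻¹ • cross d e) = ‖d‖⁻¹ * triple (f - v) d e := by
    rw [real_inner_smul_right, inner_cross_right]
  rw [dist_eq_norm, dist_eq_norm, rotateAbout]
  generalize ‖d‖⁻¹ • cross d e = e' at *
  rw [show f + ((1 - s ^ 2) / (1 + s ^ 2)) • e + (2 * s / (1 + s ^ 2)) • e' - v =
      (f - v) + (((1 - s ^ 2) / (1 + s ^ 2)) • e + (2 * s / (1 + s ^ 2)) • e') by abel,
    show f + e - v = (f - v) + e by abel, norm_add_sq_real, norm_add_sq_real (f - v) e,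
    norm_add_sq_real (_ • e), inner_add_right, real_inner_smul_right, real_inner_smul_right,
    real_inner_smul_right, real_inner_smul_left, h1, h3, norm_smul, norm_smul, mul_pow, mul_pow,
    h2, real_inner_comm e (f - v), Real.norm_eq_abs, Real.norm_eq_abs, sq_abs, sq_abs]
  rw [real_inner_comm (f - v) e]
  field_simp
  ring

theorem tendsto_rotateAbout (f d e : R3) :
    Tendsto (rotateAbout f d e) (𝓝[>] 0) (𝓝 (f + e)) := by
  have hc : Continuous (rotateAbout f d e) := by
    have : ∀ s : ℝ, 1 + s ^ 2 ≠ 0 := fun s => by positivity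
    unfold rotateAbout
    fun_prop (disch := assumption)
  have h := (hc.tendsto 0).mono_left (nhdsWithin_le_nhds (s := Set.Ioi 0))
  simpa [rotateAbout] using h

section rotateAbout

variable {f d e v : R3}

theorem dist_rotateAbout_eq (hd : d ≠ 0) (h : inner ℝ d e = 0) (h0 : triple (f - v) d e = 0)
    (h1 : inner ℝ e (f - v) = 0) (s : ℝ) : dist (rotateAbout f d e s) v = dist (f + e) v := by
  have := dist_rotateAbout_sq hd h f v s
  rw [h0, h1, mul_zero, mul_zero, sub_zero, mul_zero, add_zero] at this
  exact (sq_eq_sq₀ dist_nonneg dist_nonneg).1 this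

theorem eventually_mul_pos {A B : ℝ} (h : 0 < A ∨ A = 0 ∧ B < 0) :
    ∀ᶠ s : ℝ in 𝓝[>] 0, 0 < 4 * s / (1 + s ^ 2) * (A - s * B) := by
  have hpos : ∀ᶠ s : ℝ in 𝓝[>] 0, 0 < s := eventually_mem_nhdsWithin
  have key : ∀ᶠ s : ℝ in 𝓝[>] 0, 0 < A - s * B := by
    rcases h with h | ⟨rfl, h⟩
    · have hc : Continuous fun s : ℝ => A - s * B := by fun_prop
      have := (hc.tendsto 0).mono_left (nhdsWithin_le_nhds (s := Set.Ioi 0))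
      exact this.eventually_const_lt (by simpa using h)
    · filter_upwards [hpos] with s hs
      have := mul_pos_of_neg_of_neg (neg_neg_of_pos hs) h
      linarith
  filter_upwards [hpos, key] with s hs hk
  positivity

theorem eventually_dist_lt_rotateAbout (hd : d ≠ 0) (h : inner ℝ d e = 0)
    (hv : 0 < triple (f - v) d e ∨ triple (f - v) d e = 0 ∧ inner ℝ e (f - v) < 0) :
    ∀ᶠ s in 𝓝[>] 0, dist (f + e) v < dist (rotateAbout f d e s) v := by
  have hn : 0 < ‖d‖⁻¹ := inv_pos.2 (norm_pos_iff.2 hd)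
  have h' : 0 < ‖d‖⁻¹ * triple (f - v) d e ∨
      ‖d‖⁻¹ * triple (f - v) d e = 0 ∧ inner ℝ e (f - v) < 0 :=
    hv.imp (mul_pos hn) fun h => ⟨by rw [h.1, mul_zero], h.2⟩
  filter_upwards [eventually_mul_pos h'] with s hs
  refine (sq_lt_sq₀ dist_nonneg dist_nonneg).1 ?_
  rw [dist_rotateAbout_sq hd h]
  linarith

theorem eventually_rotateAbout_dist_lt (hd : d ≠ 0) (h : inner ℝ d e = 0)
    (hv : triple (f - v) d e < 0 ∨ triple (f - v) d e = 0 ∧ 0 < inner ℝ e (f - v)) :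
    ∀ᶠ s in 𝓝[>] 0, dist (rotateAbout f d e s) v < dist (f + e) v := by
  have hn : 0 < ‖d‖⁻¹ := inv_pos.2 (norm_pos_iff.2 hd)
  have h' : 0 < -(‖d‖⁻¹ * triple (f - v) d e) ∨
      -(‖d‖⁻¹ * triple (f - v) d e) = 0 ∧ -inner ℝ e (f - v) < 0 :=
    hv.imp (fun h => neg_pos.2 (mul_neg_of_pos_of_neg hn h))
      fun h => ⟨by rw [h.1, mul_zero, neg_zero], neg_neg_of_pos h.2⟩
  filter_upwards [eventually_mul_pos h'] with s hs
  refine (sq_lt_sq₀ dist_nonneg dist_nonneg).1 ?_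
  rw [dist_rotateAbout_sq hd h]
  linarith

end rotateAbout

/-! ### The two deformations and the extremal systems -/

section Admissible

variable {ι : Type*} {l k h : Fin 4 → ℝ} {q : ι → R3} {p : Fin 4 → R3}

/-- A vertex of maximal norm can be rotated towards the origin about the line through its
neighbours. -/
theorem Admissible.exists_norm_lt [Finite ι] [Nonempty ι] (ha : Admissible l k h q p)
    (hb : Bounds l k h q) {i : Fin 4} (hmax : ∀ j, ‖p j‖ ≤ ‖p i‖) (hi : 2 < ‖p i‖)
    (ht : 0 ≤ triple (p (i + 3)) (p i) (p (i + 1))) :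
    ∃ x, Admissible l k h q (Function.update p i x) ∧ ‖x‖ < ‖p i‖ := by
  obtain ⟨e1, e2, e3⟩ := fin_four_add_add i
  obtain ⟨n1, n2, n3⟩ := fin_four_ne i
  have hp := ha.isFrame hb
  set a := p (i + 3) with hadef
  set b := p (i + 1) with hbdef
  have hab : b - a ≠ 0 := by
    intro h0
    have := ha.two_le_dist (i + 1) (i + 3) (by fin_cases i <;> decide)
    rw [dist_eq_norm, ← hadef, ← hbdef, h0, norm_zero] at this
    norm_num at this
  have hn : ‖b - a‖ ^ 2 ≠ 0 := pow_ne_zero _ (norm_ne_zero_iff.2 hab)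
  obtain ⟨r, hr⟩ : ∃ r, r = inner ℝ (b - a) (p i - a) / ‖b - a‖ ^ 2 := ⟨_, rfl⟩
  set f := a + r • (b - a) with hf
  set e := p i - f with he
  have hfe : f + e = p i := by rw [he]; abel
  have hde : inner ℝ (b - a) e = 0 := by
    rw [he, hf, show p i - (a + r • (b - a)) = (p i - a) - r • (b - a) by abel, inner_sub_right,
      real_inner_smul_right, real_inner_self_eq_norm_sq, hr, div_mul_cancel₀ _ hn, sub_self]
  -- This is the signed position of `v` relative to the plane through the corner: for `q j` it is
  -- positive by `triple_lt_sum`, for the origin nonpositive by `ht`.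
  have htr : ∀ v, triple (f - v) (b - a) e = -triple a (p i) b +
      (triple v a (p i) + triple v (p i) b + triple v b a) := by
    intro v
    rw [he, hf]
    simp only [triple, PiLp.sub_apply, PiLp.add_apply, PiLp.smul_apply, smul_eq_mul]
    ring
  have hed : inner ℝ e (b - a) = 0 := by rw [real_inner_comm]; exact hde
  have dist_a : ∀ s, dist (rotateAbout f (b - a) e s) a = dist (p i) a := fun s => by
    rw [← hfe]
    refine dist_rotateAbout_eq hab hde ?_ ?_ s
    · rw [htr]; simp only [triple]; ring
    · rw [hf, add_sub_cancel_left, real_inner_smul_right, hed, mul_zero]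
  have dist_b : ∀ s, dist (rotateAbout f (b - a) e s) b = dist (p i) b := fun s => by
    rw [← hfe]
    refine dist_rotateAbout_eq hab hde ?_ ?_ s
    · rw [htr]; simp only [triple]; ring
    · rw [hf, show a + r • (b - a) - b = (r - 1) • (b - a) by rw [sub_smul, one_smul]; abel,
        real_inner_smul_right, hed, mul_zero]
  have hlim := tendsto_rotateAbout f (b - a) e
  rw [hfe] at hlim
  have hlt : ∀ᶠ s in 𝓝[>] 0, ‖rotateAbout f (b - a) e s‖ < ‖p i‖ := by
    have := eventually_rotateAbout_dist_lt (f := f) (v := 0) hab hde ?_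
    · simpa only [hfe, dist_zero_right] using this
    have h0 : triple (f - 0) (b - a) e = -triple a (p i) b := by
      rw [htr]; simp [triple]
    rw [h0, sub_zero, neg_neg_iff_pos, neg_eq_zero]
    -- If the corner is coplanar with the origin, the first-order term vanishes; `p i` lies beyond
    -- the line through its neighbours, so the second-order term shortens it.
    refine ht.lt_or_eq.imp id fun h0 => ⟨h0.symm, ?_⟩
    obtain ⟨j⟩ := ‹Nonempty ι›
    obtain ⟨z, -, -, hx, hS⟩ := IsAxis.combination_of_coplanar hp (ha.encircles j) i h0.symm
    have hq := IsAxis.triple_lt_of_coplanar hp (ha.encircles j) i h0.symm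
    have he0 : e ≠ 0 := by
      intro he0
      have := htr (q j)
      rw [← h0, he0] at this
      simp only [triple, PiLp.zero_apply] at this hq
      linarith
    rw [← hadef, ← hbdef] at hx hS
    generalize triple (q j) (p i) b / z = α at hx hS
    generalize triple (q j) a (p i) / z = β at hx hS
    have hx' : p i = (α + β) • f + (β - (α + β) * r) • (b - a) := by
      rw [hx, hf]; module
    have h1 : inner ℝ e (p i) = (α + β) * inner ℝ e f := by
      rw [hx', inner_add_right, real_inner_smul_right, real_inner_smul_right, hed, mul_zero,
        add_zero]
    have h2 : inner ℝ e (p i) = inner ℝ e f + ‖e‖ ^ 2 := by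
      rw [← hfe, inner_add_right, real_inner_self_eq_norm_sq]
    have h3 : 0 < ‖e‖ ^ 2 := by positivity
    have h4 : 0 < (α + β - 1) * inner ℝ e f := by linarith
    exact pos_of_mul_pos_right h4 (by linarith)
  have := ha.eventually_update hb hlim
    ((hlim.norm.eventually_const_lt hi).mono fun _ h => h.le)
    (hlt.mono fun s hs => hs.le.trans (ha.norm_le i))
    (Eventually.of_forall fun s => by rw [dist_b]; exact ha.two_le_dist _ _ n1.symm)
    (Eventually.of_forall fun s => by rw [dist_b]; exact ha.dist_le i)
    (Eventually.of_forall fun s => by rw [dist_a]; exact ha.two_le_dist _ _ n3.symm)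
    (Eventually.of_forall fun s => by
      rw [dist_a, dist_comm]; have := ha.dist_le (i + 3); rwa [e3] at this)
    (fun j => by
      rcases (ha.le_dist i j).lt_or_eq with hj | hj
      · exact ((hlim.dist tendsto_const_nhds).eventually_const_lt hj).mono fun _ h => h.le
      · rw [hj]
        nth_rewrite 1 [← hfe]
        refine (eventually_dist_lt_rotateAbout hab hde (Or.inl ?_)).mono fun _ h => h.le
        have := (ha.isAxis hb j).triple_lt_sum hp (ha.encircles j) i hmax
          (by rw [← hj]; exact hb.h_le i) ht
        rw [htr]
        linarith)
  obtain ⟨s, hs1, hs2⟩ := (this.and hlt).exists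
  exact ⟨_, hs1, hs2⟩

/-- If an edge is too short, then one of its ends can be rotated away from the other about the
line through the origin and its other neighbour. -/
theorem Admissible.exists_lt_dist [Finite ι] [Nonempty ι] (ha : Admissible l k h q p)
    (hb : Bounds l k h q) {i : Fin 4} (hi : dist (p i) (p (i + 1)) < k i)
    (ht : 0 ≤ triple (p (i + 3)) (p i) (p (i + 1))) :
    ∃ x, Admissible l k h q (Function.update p i x) ∧ ‖x‖ = ‖p i‖ ∧
      dist x (p (i + 3)) = dist (p i) (p (i + 3)) ∧
      dist (p i) (p (i + 1)) < dist x (p (i + 1)) := by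
  obtain ⟨e1, e2, e3⟩ := fin_four_add_add i
  obtain ⟨n1, n2, n3⟩ := fin_four_ne i
  have hp := ha.isFrame hb
  set a := p (i + 3) with hadef
  set b := p (i + 1) with hbdef
  have ha0 : a ≠ 0 := by
    intro h0
    have := ha.two_le_norm (i + 3)
    rw [← hadef, h0, norm_zero] at this
    norm_num at this
  have hd : -a ≠ 0 := neg_ne_zero.2 ha0
  have hn : ‖a‖ ^ 2 ≠ 0 := pow_ne_zero _ (norm_ne_zero_iff.2 ha0)
  obtain ⟨r, hr⟩ : ∃ r, r = inner ℝ a (p i) / ‖a‖ ^ 2 := ⟨_, rfl⟩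
  set f := r • a with hf
  set e := p i - f with he
  have hfe : f + e = p i := by rw [he]; abel
  have hea : inner ℝ e a = 0 := by
    rw [real_inner_comm, he, hf, inner_sub_right, real_inner_smul_right,
      real_inner_self_eq_norm_sq, hr, div_mul_cancel₀ _ hn, sub_self]
  have hde : inner ℝ (-a) e = 0 := by rw [inner_neg_left, real_inner_comm, hea, neg_zero]
  -- The direction `-a` makes this positive for `q j`, by encircling, and nonnegative for `b`, by
  -- `ht`.
  have htr : ∀ v, triple (f - v) (-a) e = triple v a (p i) := by
    intro v
    rw [he, hf]
    simp only [triple, PiLp.sub_apply, PiLp.neg_apply, PiLp.smul_apply, smul_eq_mul]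
    ring
  have norm_eq : ∀ s, ‖rotateAbout f (-a) e s‖ = ‖p i‖ := fun s => by
    rw [← dist_zero_right, ← dist_zero_right, ← hfe]
    refine dist_rotateAbout_eq hd hde ?_ ?_ s
    · rw [htr]; simp [triple]
    · rw [sub_zero, hf, real_inner_smul_right, hea, mul_zero]
  have dist_a : ∀ s, dist (rotateAbout f (-a) e s) a = dist (p i) a := fun s => by
    rw [← hfe]
    refine dist_rotateAbout_eq hd hde ?_ ?_ s
    · rw [htr, triple_self_left]
    · rw [inner_sub_right, hf, real_inner_smul_right, hea, mul_zero, sub_zero]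
  have hlim := tendsto_rotateAbout f (-a) e
  rw [hfe] at hlim
  have hlt : ∀ᶠ s in 𝓝[>] 0, dist (p i) b < dist (rotateAbout f (-a) e s) b := by
    have := eventually_dist_lt_rotateAbout (f := f) (v := b) hd hde ?_
    · rwa [hfe] at this
    rw [htr, triple_rotate]
    refine ht.lt_or_eq.imp id fun h0 => ⟨h0.symm, ?_⟩
    obtain ⟨j⟩ := ‹Nonempty ι›
    obtain ⟨z, hz, -, hx, -⟩ := IsAxis.combination_of_coplanar hp (ha.encircles j) i h0.symm
    have hq := (ha.encircles j).triple_pos (i + 3)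
    rw [e3, ← hadef] at hq
    have he0 : e ≠ 0 := by
      intro he0
      have := htr (q j)
      rw [he0] at this
      simp only [triple, PiLp.zero_apply] at this hq
      linarith
    rw [← hadef, ← hbdef] at hx
    have hβ := div_pos hq hz
    generalize triple (q j) (p i) b / z = α at hx
    generalize triple (q j) a (p i) / z = β at hx hβ
    have h1 : inner ℝ e (p i) = β * inner ℝ e b := by
      nth_rewrite 1 [hx]
      rw [inner_add_right, real_inner_smul_right, real_inner_smul_right, hea, mul_zero, zero_add]
    have h2 : inner ℝ e (p i) = ‖e‖ ^ 2 := by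
      rw [← hfe, inner_add_right, real_inner_self_eq_norm_sq, hf, real_inner_smul_right, hea,
        mul_zero, zero_add]
    have h3 : 0 < ‖e‖ ^ 2 := by positivity
    have h4 : 0 < inner ℝ e b := pos_of_mul_pos_right (by linarith : 0 < β * inner ℝ e b) hβ.le
    rw [inner_sub_right, hf, real_inner_smul_right, hea, mul_zero]
    linarith
  have := ha.eventually_update hb hlim
    (Eventually.of_forall fun s => by rw [norm_eq]; exact ha.two_le_norm i)
    (Eventually.of_forall fun s => by rw [norm_eq]; exact ha.norm_le i)
    (hlt.mono fun s hs => (ha.two_le_dist _ _ n1.symm).trans hs.le)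
    (((hlim.dist tendsto_const_nhds).eventually_lt_const hi).mono fun _ h => h.le)
    (Eventually.of_forall fun s => by rw [dist_a]; exact ha.two_le_dist _ _ n3.symm)
    (Eventually.of_forall fun s => by
      rw [dist_a, dist_comm]; have := ha.dist_le (i + 3); rwa [e3] at this)
    (fun j => by
      have := eventually_dist_lt_rotateAbout (f := f) (v := q j) hd hde (Or.inl ?_)
      · rw [hfe] at this
        exact this.mono fun _ h => (ha.le_dist i j).trans h.le
      · have hq := (ha.encircles j).triple_pos (i + 3)
        rw [e3] at hq
        rw [htr]
        exact hq)
  obtain ⟨s, hs1, hs2⟩ := (this.and hlt).exists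
  exact ⟨_, hs1, norm_eq s, dist_a s, hs2⟩

theorem Admissible.exists_norm_eq_two [Finite ι] [Nonempty ι] (ha : Admissible l k h q p)
    (hb : Bounds l k h q) : ∃ p', Admissible l k h q p' ∧ ∀ i, ‖p' i‖ = 2 := by
  obtain ⟨p₀, h₀, hmin⟩ := (isCompact_admissible hb).exists_isMinOn ⟨p, ha⟩
    (show ContinuousOn (fun p : Fin 4 → R3 => ∑ i, ‖p i‖) _ by fun_prop)
  refine ⟨p₀, h₀, ?_⟩
  obtain ⟨i, hi⟩ := Finite.exists_max fun i => ‖p₀ i‖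
  by_contra hcon
  have hi2 : 2 < ‖p₀ i‖ := by
    by_contra hle
    push Not at hle
    exact hcon fun j => le_antisymm ((hi j).trans hle) (h₀.two_le_norm j)
  -- Reflection preserves all norms, so the reflected system is again a minimiser.
  obtain ⟨p₁, h₁, hnorm, -, ht⟩ := h₀.exists_mirror hb i
  obtain ⟨x, hx, hlt⟩ := h₁.exists_norm_lt hb (fun j => by rw [hnorm, hnorm]; exact hi j)
    (by rwa [hnorm]) ht
  have hle : ∑ j, ‖p₀ j‖ ≤ ∑ j, ‖Function.update p₁ i x j‖ := hmin hx
  refine hle.not_gt ?_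
  refine Finset.sum_lt_sum (fun j _ => ?_) ⟨i, Finset.mem_univ i, ?_⟩
  · rcases eq_or_ne j i with rfl | hj
    · rw [Function.update_self, ← hnorm]; exact hlt.le
    · rw [Function.update_of_ne hj, hnorm]
  · rw [Function.update_self, ← hnorm]; exact hlt

theorem Admissible.exists_extremal [Finite ι] [Nonempty ι] (ha : Admissible l k h q p)
    (hb : Bounds l k h q) : ∃ p', Admissible l k h q p' ∧ (∀ i, ‖p' i‖ = 2) ∧
      ∀ i, dist (p' i) (p' (i + 1)) = k i := by
  obtain ⟨p', ha', hn'⟩ := ha.exists_norm_eq_two hb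
  have hclosed : IsClosed {p : Fin 4 → R3 | ∀ i, ‖p i‖ = 2} := by
    simp only [Set.ofPred_forall]
    exact isClosed_iInter fun i => isClosed_eq (by fun_prop) continuous_const
  obtain ⟨p₀, ⟨h₀, hn₀⟩, hmax⟩ := ((isCompact_admissible hb).inter_right hclosed).exists_isMaxOn
    ⟨p', ha', hn'⟩
    (show ContinuousOn (fun p : Fin 4 → R3 => ∑ i, dist (p i) (p (i + 1))) _ by fun_prop)
  refine ⟨p₀, h₀, hn₀, fun i => ?_⟩
  by_contra hne
  have hlt := lt_of_le_of_ne (h₀.dist_le i) hne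
  obtain ⟨e1, e2, e3⟩ := fin_four_add_add i
  obtain ⟨n1, n2, n3⟩ := fin_four_ne i
  obtain ⟨p₁, h₁, hnorm, hdist, ht⟩ := h₀.exists_mirror hb i
  obtain ⟨x, hx, hxn, hxa, hxb⟩ := h₁.exists_lt_dist hb (by rwa [hdist]) ht
  have hle : ∑ j, dist (Function.update p₁ i x j) (Function.update p₁ i x (j + 1)) ≤
      ∑ j, dist (p₀ j) (p₀ (j + 1)) := by
    refine hmax ⟨hx, fun j => ?_⟩
    rcases eq_or_ne j i with rfl | hj
    · rw [Function.update_self, hxn, hnorm, hn₀]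
    · rw [Function.update_of_ne hj, hnorm, hn₀]
  rw [← Finset.sum_congr rfl fun j _ => hdist j, sum_fin_four _ i, sum_fin_four _ i, e1, e2, e3,
    Function.update_self, Function.update_of_ne n1, Function.update_of_ne n2,
    Function.update_of_ne n3, dist_comm (p₁ (i + 3)) x, hxa, dist_comm (p₁ i) (p₁ (i + 3))] at hle
  linarith

end Admissible

/-! ### Lengthening the axes, and the theorem -/

theorem Encircles.smul {p : Fin 4 → R3} {q : R3} (he : Encircles p q) {t : ℝ} (ht : 0 < t) :
    Encircles p (t • q) where
  triple_pos i := by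
    rw [triple_smul_left]
    exact mul_pos ht (he.triple_pos i)
  dual v hv := by
    rw [real_inner_smul_right]
    exact mul_nonneg ht.le (he.dual v hv)

section Admissible

variable {ι : Type*} {l k h : Fin 4 → ℝ} {q : ι → R3} {p : Fin 4 → R3}

theorem Admissible.exists_extremal_axes [Finite ι] [Nonempty ι] (ha : Admissible l k h q p)
    (hb : Bounds l k h q) {L : ℝ} (hL : L ≤ √8) (hq : ∀ j, ‖q j‖ ≤ L) :
    ∃ p' q', Admissible l k h q' p' ∧ Bounds l k h q' ∧ (∀ i, ‖p' i‖ = 2) ∧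
      (∀ i, dist (p' i) (p' (i + 1)) = k i) ∧ (∀ j : ι, ‖q' j‖ = L) ∧
      ∀ j m, 2 ≤ dist (q j) (q m) → dist (q j) (q m) ≤ dist (q' j) (q' m) := by
  have hpos : ∀ j, 0 < ‖q j‖ := fun j => by linarith [hb.two_le_norm j]
  have h1 : ∀ j, 1 ≤ L / ‖q j‖ := fun j => (one_le_div (hpos j)).2 (hq j)
  have hn : ∀ j, ‖(L / ‖q j‖) • q j‖ = L := fun j => by
    rw [norm_smul, Real.norm_of_nonneg (by linarith [h1 j]), div_mul_cancel₀ _ (hpos j).ne']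
  have hb' : Bounds l k h fun j => (L / ‖q j‖) • q j :=
    ⟨hb.l_lt, hb.k_le, hb.two_le_h, hb.h_le,
      fun j => by rw [hn]; exact (hb.two_le_norm j).trans (hq j), fun j => by rw [hn]; exact hL⟩
  have ha' : Admissible l k h (fun j => (L / ‖q j‖) • q j) p :=
    ⟨⟨ha.two_le_norm, ha.norm_le, ha.two_le_dist, ha.dist_le, fun i j => (ha.le_dist i j).trans
      (dist_le_dist_smul (h1 j) (hb.two_le_norm j) ((ha.norm_le i).trans (hb.l_lt i).le)
        ((hb.two_le_h i).trans (ha.le_dist i j)))⟩,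
      fun j => (ha.encircles j).smul (zero_lt_one.trans_le (h1 j))⟩
  obtain ⟨p', h', hnorm, hdist⟩ := ha'.exists_extremal hb'
  refine ⟨p', _, h', hb', hnorm, hdist, hn, fun j m hjm => ?_⟩
  -- The two points move one after the other; the first move keeps their distance at least 2, as the
  -- second requires.
  have d1 := dist_le_dist_smul (h1 m) (hb.two_le_norm m) (hb.norm_le j) hjm
  refine d1.trans ?_
  rw [dist_comm (q j), dist_comm (_ • q j)]
  exact dist_le_dist_smul (h1 j) (hb.two_le_norm j) ((hn m).le.trans hL)
    (by rw [dist_comm]; exact hjm.trans d1)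

theorem MetricConfig.neg (hc : MetricConfig l k h q p) : MetricConfig l k h (-q) (-p) where
  two_le_norm i := by simpa using hc.two_le_norm i
  norm_le i := by simpa using hc.norm_le i
  two_le_dist i j hij := by simpa using hc.two_le_dist i j hij
  dist_le i := by simpa using hc.dist_le i
  le_dist i j := by simpa using hc.le_dist i j

theorem Bounds.neg (hb : Bounds l k h q) : Bounds l k h (-q) :=
  ⟨hb.l_lt, hb.k_le, hb.two_le_h, hb.h_le, fun j => by simpa using hb.two_le_norm j,
    fun j => by simpa using hb.norm_le j⟩

theorem MetricConfig.exists_extremal [Finite ι] [Nonempty ι] (hc : MetricConfig l k h q p)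
    (hb : Bounds l k h q) (hlink : ∀ j, HalfLineLinks (q j) p) {L : ℝ} (hL : L ≤ √8)
    (hq : ∀ j, ‖q j‖ ≤ L) :
    ∃ p' q', Admissible l k h q' p' ∧ Bounds l k h q' ∧ (∀ i, ‖p' i‖ = 2) ∧
      (∀ i, dist (p' i) (p' (i + 1)) = k i) ∧ (∀ j : ι, ‖q' j‖ = L) ∧
      ∀ j m, 2 ≤ dist (q j) (q m) → dist (q j) (q m) ≤ dist (q' j) (q' m) := by
  have hp := hc.isFrame hb
  have hor := fun j => (hlink j).encircles hp (hc.isAxis hb j)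
  by_cases hall : ∀ j, Encircles p (q j)
  · exact Admissible.exists_extremal_axes ⟨hc, hall⟩ hb hL hq
  · push Not at hall
    obtain ⟨j0, hj0⟩ := hall
    have h0 := (hor j0).resolve_left hj0
    have hneg : ∀ j, Encircles (-p) (-q j) := fun j =>
      (hor j).resolve_left fun he => IsAxis.not_encircles_neg hp he h0
    have := Admissible.exists_extremal_axes ⟨hc.neg, hneg⟩ hb.neg hL (by simpa using hq)
    simpa using this

end Admissible

theorem mainTheorem1 (l k h : Fin 4 → ℝ) (L : ℝ)
    (hl : ∀ i, l i < Real.sqrt 8)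
    (hk : ∀ i, k i ∈ Set.Icc (2 : ℝ) 2.61)
    (hh : ∀ i, h i ∈ Set.Icc (2 : ℝ) (Real.sqrt 8))
    (hL : L ∈ Set.Icc (2 : ℝ) (Real.sqrt 8)) :
    (∀ ε : ℝ, 2 ≤ ε →
      (∃ (p : Fin 4 → R3) (q : Fin 2 → R3), IsSevenPointConfig l k h ε L p q) →
      ∃ (p : Fin 4 → R3) (q : Fin 2 → R3), IsSevenPointConfig l k h ε L p q ∧
        (∀ i, ‖p i‖ = 2) ∧ (∀ i, dist (p i) (p (i + 1)) = k i) ∧ (∀ j, ‖q j‖ = L)) ∧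
    ((∃ (p : Fin 4 → R3) (q : R3), IsSixPointConfig l k h L p q) →
      ∃ (p : Fin 4 → R3) (q : R3), IsSixPointConfig l k h L p q ∧
        (∀ i, ‖p i‖ = 2) ∧ (∀ i, dist (p i) (p (i + 1)) = k i) ∧ ‖q‖ = L) := by
  constructor
  · rintro ε hε ⟨p, q, hc⟩
    obtain ⟨p', q', ha, hb, hn, hd, hq, hqq⟩ := MetricConfig.exists_extremal (q := q)
      ⟨hc.two_le_norm_p, hc.norm_p_le, hc.two_le_dist_p, hc.dist_p_le, hc.le_dist_p_q⟩
      ⟨hl, fun i => (hk i).2, fun i => (hh i).1, fun i => (hh i).2, hc.two_le_norm_q,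
        fun j => (hc.norm_q_le j).trans hL.2⟩ hc.links hL.2 hc.norm_q_le
    exact ⟨p', q', ⟨ha.two_le_norm, hb.two_le_norm, ha.two_le_dist, ha.le_dist,
      hc.le_dist_q.trans (hqq 0 1 (hε.trans hc.le_dist_q)), ha.norm_le, fun j => (hq j).le,
      ha.dist_le, fun j => (ha.isAxis hb j).halfLineLinks (ha.isFrame hb) (ha.encircles j)⟩,
      hn, hd, hq⟩
  · rintro ⟨p, q, hc⟩
    obtain ⟨p', q', ha, hb, hn, hd, hq, -⟩ := MetricConfig.exists_extremal (ι := Unit)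
      (q := fun _ => q)
      ⟨hc.two_le_norm_p, hc.norm_p_le, hc.two_le_dist_p, hc.dist_p_le, fun i _ => hc.le_dist_p_q i⟩
      ⟨hl, fun i => (hk i).2, fun i => (hh i).1, fun i => (hh i).2, fun _ => hc.two_le_norm_q,
        fun _ => hc.norm_q_le.trans hL.2⟩ (fun _ => hc.links) hL.2 (fun _ => hc.norm_q_le)
    exact ⟨p', q' (), ⟨ha.two_le_norm, hb.two_le_norm _, ha.two_le_dist, fun i => ha.le_dist i _,
      ha.norm_le, (hq _).le, ha.dist_le,
      (ha.isAxis hb _).halfLineLinks (ha.isFrame hb) (ha.encircles _)⟩, hn, hd, hq _⟩
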